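/- Let $H^1=\mathbb{R}^3$ with coordinates $(x,y,t)$ and let $$\Delta_{H^1}=\partial_x^2+\partial_y^2+4(x^2+y^2)\partial_t^2+4y\,\partial_x\partial_t-4x\,\partial_y\partial_t .$$ The equation $\Delta_{H^1}u=0$ is the Euler–Lagrange equation of $$\mathcal L=\tfrac12u_x^2+\tfrac12u_y^2+2(x^2+y^2)u_t^2+2y\,u_xu_t-2x\,u_yu_t .$$ Write $(x^1,x^2,x^3)=(x,y,t)$. For a smooth vector field $S=\xi^i(x,y,t,u)\,\partial_{x^i}+\eta(x,y,t,u)\,\partial_u$ on $\mathbb{R}^3\times\mathbb{R}$ let $S^{(k)}$ be its $k$-th extension to the jet space, with coefficients $\eta^{(1)}_i=D_i\eta-(D_i\xi^j)u_j$ and $\eta^{(2)}_{ij}=D_j\eta^{(1)}_i-(D_j\xi^l)u_{il}$, where $D_i$ is the total derivative. $S$ is a Lie point symmetry of $\Delta_{H^1}u=0$ if $S^{(2)}(\Delta_{H^1}u)=0$ at every jet at which $\Delta_{H^1}u=0$; it is a Noether symmetry if moreover there are smooth functions $\varphi^1,\varphi^2,\varphi^3$ of $x,y,t,u$ and finitely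 many derivatives of $u$ with $$S^{(1)}\mathcal L+\mathcal L\,D_i\xi^i=D_i\varphi^i$$ identically on the jet space. Put $$T=\partial_t,\quad R=y\,\partial_x-x\,\partial_y,\quad \tilde X=\partial_x-2y\,\partial_t,\quad \tilde Y=\partial_y+2x\,\partial_t,$$ $$V_1=(xt-x^2y-y^3)\partial_x+(yt+x^3+xy^2)\partial_y+(t^2-(x^2+y^2)^2)\partial_t-tu\,\partial_u,$$ $$V_2=(t-4xy)\partial_x+(3x^2-y^2)\partial_y-(2yt+2x^3+2xy^2)\partial_t+2yu\,\partial_u,$$ $$V_3=(x^2-3y^2)\partial_x+(t+4xy)\partial_y+(2xt-2x^2y-2y^3)\partial_t-2xu\,\partial_u,$$ $$Z=x\,\partial_x+y\,\partial_y+2t\,\partial_t,\qquad U=u\,\partial_u,\qquad W_\beta=\beta(x,y,t)\,\partial_u .$$ **Theorem.** The set of Noether symmetries of $\Delta_{H^1}u=0$ is exactly the Lie algebra of vector fields generated, under real linear combinations and Lie brackets, by $T,R,\tilde X,\tilde Y,V_1,V_2,V_3$ and all $W_\beta$ with $\beta\in C^\infty(\mathbb{R}^3)$, $\Delta_{H^1}\beta=0$.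 The fields $Z$ and $U$ are Lie point symmetries of $\Delta_{H^1}u=0$ but not Noether symmetries. -/

import Mathlib

open scoped ContDiff

noncomputable section

namespace Kohn

/-- Points of the Heisenberg group `H¹ = ℝ³`; the coordinates `0, 1, 2` are `x, y, t`. -/
abbrev Pt : Type := Fin 3 → ℝ

/-- Multi-indices: `α i` is the number of derivatives taken in the `i`-th variable. -/
abbrev MIdx : Type := Fin 3 →₀ ℕ

/-- The multi-index of one derivative in the `i`-th variable. -/
abbrev e (i : Fin 3) : MIdx := Finsupp.single i 1

/-- Points of the (infinite) jet space: a base point together with the jet coordinates `u_α`,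
where `u_0` is `u` itself. -/
abbrev Jet : Type := Pt × (MIdx → ℝ)

/-- A differential function: a smooth function of `x, y, t` and of finitely many of the jet
coordinates `u_α`. -/
def IsDifferentialFunction (P : Jet → ℝ) : Prop :=
  ∃ (s : Finset MIdx) (g : Pt × (s → ℝ) → ℝ),
    ContDiff ℝ ∞ g ∧ ∀ z : Jet, P z = g (z.1, fun α => z.2 α)

/-- The partial derivative `∂P/∂xⁱ` on the jet space. -/
def partialX (i : Fin 3) (P : Jet → ℝ) (z : Jet) : ℝ :=
  deriv (fun r : ℝ => P (Function.update z.1 i r, z.2)) (z.1 i)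

/-- The partial derivative `∂P/∂u_α` on the jet space. -/
def partialU (α : MIdx) (P : Jet → ℝ) (z : Jet) : ℝ :=
  deriv (fun r : ℝ => P (z.1, Function.update z.2 α r)) (z.2 α)

/-- The total derivative `D_i = ∂/∂xⁱ + ∑_α u_{α + e i} ∂/∂u_α`. On differential functions only
finitely many terms of the sum are nonzero. -/
def totalD (i : Fin 3) (P : Jet → ℝ) (z : Jet) : ℝ :=
  partialX i P z + ∑ᶠ α : MIdx, z.2 (α + e i) * partialU α P z

/-- Vector fields `S = ξⁱ(x,u) ∂/∂xⁱ + η(x,u) ∂/∂u` on `ℝ³ × ℝ`. -/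
abbrev VField : Type := Pt × ℝ → Pt × ℝ

/-- The coefficient `ξⁱ(x,u)` as a function on the jet space. -/
def xi (S : VField) (i : Fin 3) (z : Jet) : ℝ := (S (z.1, z.2 0)).1 i

/-- The coefficient `η(x,u)` as a function on the jet space. -/
def eta (S : VField) (z : Jet) : ℝ := (S (z.1, z.2 0)).2

/-- `η⁽¹⁾_i = D_i η - (D_i ξʲ) u_j`. -/
def eta1 (S : VField) (i : Fin 3) (z : Jet) : ℝ :=
  totalD i (eta S) z - ∑ j, totalD i (xi S j) z * z.2 (e j)

/-- `η⁽²⁾_{ij} = D_j η⁽¹⁾_i - (D_j ξˡ) u_{il}`. -/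
def eta2 (S : VField) (i j : Fin 3) (z : Jet) : ℝ :=
  totalD j (eta1 S i) z - ∑ l, totalD j (xi S l) z * z.2 (e i + e l)

/-- The first extension `S⁽¹⁾`, applied to a function on the jet space. -/
def prolong1 (S : VField) (P : Jet → ℝ) (z : Jet) : ℝ :=
  ∑ i, xi S i z * partialX i P z + eta S z * partialU 0 P z
    + ∑ i, eta1 S i z * partialU (e i) P z

/-- The second extension `S⁽²⁾`, applied to a function on the jet space. The coordinates of
order two are the `u_{ij}` with `i ≤ j`. -/
def prolong2 (S : VField) (P : Jet → ℝ) (z : Jet) : ℝ :=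
  prolong1 S P z + ∑ i, ∑ j ∈ Finset.Ici i, eta2 S i j z * partialU (e i + e j) P z

/-- `S` is a Lie point symmetry of the second order equation `F = 0`. -/
def IsLiePointSymmetry (F : Jet → ℝ) (S : VField) : Prop :=
  ContDiff ℝ ∞ S ∧ ∀ z : Jet, F z = 0 → prolong2 S F z = 0

/-- `S` is a Noether symmetry of the second order equation `F = 0` with the first order
Lagrangian `L`: a Lie point symmetry such that `S⁽¹⁾L + L D_i ξⁱ = D_i φⁱ` for some vector `φ` of
differential functions (of any finite order). -/
def IsNoetherSymmetry (F L : Jet → ℝ) (S : VField) : Prop :=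
  IsLiePointSymmetry F S ∧
    ∃ φ : Fin 3 → Jet → ℝ, (∀ i, IsDifferentialFunction (φ i)) ∧
      ∀ z : Jet, prolong1 S L z + L z * ∑ i, totalD i (xi S i) z = ∑ i, totalD i (φ i) z

/-- The left-hand side of the Kohn–Laplace equation `Δ u = 0`, as a function on the jet space:
`u_xx + u_yy + 4(x² + y²) u_tt + 4y u_xt - 4x u_yt`. -/
def kohnEq (z : Jet) : ℝ :=
  z.2 (e 0 + e 0) + z.2 (e 1 + e 1) + 4 * (z.1 0 ^ 2 + z.1 1 ^ 2) * z.2 (e 2 + e 2)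
    + 4 * z.1 1 * z.2 (e 0 + e 2) - 4 * z.1 0 * z.2 (e 1 + e 2)

/-- The Lagrangian `½u_x² + ½u_y² + 2(x² + y²)u_t² + 2y u_x u_t - 2x u_y u_t`. -/
def kohnLagrangian (z : Jet) : ℝ :=
  z.2 (e 0) ^ 2 / 2 + z.2 (e 1) ^ 2 / 2 + 2 * (z.1 0 ^ 2 + z.1 1 ^ 2) * z.2 (e 2) ^ 2
    + 2 * z.1 1 * z.2 (e 0) * z.2 (e 2) - 2 * z.1 0 * z.2 (e 1) * z.2 (e 2)

/-- The partial derivative of a function on `ℝ³` in the `i`-th variable. -/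
def pd (i : Fin 3) (b : Pt → ℝ) (p : Pt) : ℝ := fderiv ℝ b p (Pi.single i 1)

/-- The Kohn–Laplace operator on functions on `ℝ³`. -/
def kohnLaplacian (b : Pt → ℝ) (p : Pt) : ℝ :=
  pd 0 (pd 0 b) p + pd 1 (pd 1 b) p + 4 * (p 0 ^ 2 + p 1 ^ 2) * pd 2 (pd 2 b) p
    + 4 * p 1 * pd 0 (pd 2 b) p - 4 * p 0 * pd 1 (pd 2 b) p

/-- The vector field on `ℝ³ × ℝ` with coefficients `a, b, c, h` at `∂/∂x, ∂/∂y, ∂/∂t, ∂/∂u`,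
given as functions of `x, y, t, u`. -/
def mkField (a b c h : ℝ → ℝ → ℝ → ℝ → ℝ) : VField := fun q =>
  (![a (q.1 0) (q.1 1) (q.1 2) q.2, b (q.1 0) (q.1 1) (q.1 2) q.2, c (q.1 0) (q.1 1) (q.1 2) q.2],
    h (q.1 0) (q.1 1) (q.1 2) q.2)

def T : VField := mkField (fun _ _ _ _ => 0) (fun _ _ _ _ => 0) (fun _ _ _ _ => 1) (fun _ _ _ _ => 0)

def R : VField := mkField (fun _ y _ _ => y) (fun x _ _ _ => -x) (fun _ _ _ _ => 0) (fun _ _ _ _ => 0)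

def Xtilde : VField :=
  mkField (fun _ _ _ _ => 1) (fun _ _ _ _ => 0) (fun _ y _ _ => -2 * y) (fun _ _ _ _ => 0)

def Ytilde : VField :=
  mkField (fun _ _ _ _ => 0) (fun _ _ _ _ => 1) (fun x _ _ _ => 2 * x) (fun _ _ _ _ => 0)

def V1 : VField :=
  mkField (fun x y t _ => x * t - x ^ 2 * y - y ^ 3) (fun x y t _ => y * t + x ^ 3 + x * y ^ 2)
    (fun x y t _ => t ^ 2 - (x ^ 2 + y ^ 2) ^ 2) (fun _ _ t u => -(t * u))

def V2 : VField :=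
  mkField (fun x y t _ => t - 4 * x * y) (fun x y _ _ => 3 * x ^ 2 - y ^ 2)
    (fun x y t _ => -(2 * y * t + 2 * x ^ 3 + 2 * x * y ^ 2)) (fun _ y _ u => 2 * y * u)

def V3 : VField :=
  mkField (fun x y _ _ => x ^ 2 - 3 * y ^ 2) (fun x y t _ => t + 4 * x * y)
    (fun x y t _ => 2 * x * t - 2 * x ^ 2 * y - 2 * y ^ 3) (fun x _ _ u => -(2 * x * u))

/-- The dilation `x ∂/∂x + y ∂/∂y + 2t ∂/∂t`. -/
def Z : VField :=
  mkField (fun x _ _ _ => x) (fun _ y _ _ => y) (fun _ _ t _ => 2 * t) (fun _ _ _ _ => 0)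

/-- The scaling `u ∂/∂u`. -/
def U : VField := mkField (fun _ _ _ _ => 0) (fun _ _ _ _ => 0) (fun _ _ _ _ => 0) (fun _ _ _ u => u)

/-- The field `β(x,y,t) ∂/∂u`. -/
def W (β : Pt → ℝ) : VField := fun q => (0, β q.1)

/-- The generators `T, R, X̃, Ỹ, V₁, V₂, V₃` and all `W_β` with `β` smooth and `Δβ = 0`. -/
def generators : Set VField :=
  {T, R, Xtilde, Ytilde, V1, V2, V3} ∪
    {S | ∃ β : Pt → ℝ, ContDiff ℝ ∞ β ∧ (∀ p, kohnLaplacian β p = 0) ∧ S = W β}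

/-- The Lie algebra of vector fields generated by `G`: the smallest real vector space of fields
that contains `G` and is closed under the Lie bracket. -/
def lieAlgebraGenerated (G : Set VField) : Set VField :=
  {S | ∀ A : Submodule ℝ VField, G ⊆ A →
    (∀ V ∈ A, ∀ V' ∈ A, VectorField.lieBracket ℝ V V' ∈ A) → S ∈ A}

end Kohn

end

/-! ### Smooth functions on `ℝ³` and their partial derivatives -/

open scoped ContDiff

noncomputable section

namespace Kohn

/-! In the left-invariant frame `X = ∂x + 2y ∂t`, `Y = ∂y - 2x ∂t`, where `[Y, X] = 4T`, the
operator is `X² + Y²`. The determining equations force a Lie point symmetry to have `ξ` free of `u`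
and `η` affine in `u` (`IsLiePointSymmetry.exists_projField`). Its base part then preserves the
contact structure and is conformal on the horizontal planes, so it is encoded by a single function
`h`, its contraction with the contact form `dt - 2y dx + 2x dy`, subject to `X²h = Y²h` and `XYh +
YXh = 0`. The `u`-component is `(c - Th/2) u + b` with `c` constant and `b` Kohn-harmonic
(`IsLiePointSymmetry.exists_contactField`).

The system for `h` is of finite type: commuting derivatives expresses all third derivatives through
`T` and gives `TX²h = T²Xh = T²Yh = 0`. Hence `h` is determined by eight numbers at the origin
(`IsContactPotential.eq_zero`) and is a combination of eight explicit polynomials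
(`IsContactPotential.eq_combination`).

For such a field, `S⁽¹⁾L + L D_i ξⁱ` equals `2cL` plus a total divergence (`prolong1_contactField`).
The Lagrangian is a sum of two squares, so its integral over a suitable compactly supported function
is positive, while a divergence integrates to zero; thus the Noether condition is `c = 0`
(`isNoetherSymmetry_contactField_iff`). The fields with `c = 0` are closed under brackets. The
listed generators provide the `b`-part and every polynomial potential except `t`, which comes from
`[T, V₁] = Z - U`. Both `Z` and `U` have `c = 1`. -/

/-- The algebra of smooth functions on `ℝ³`. -/
def smoothAlg : Subalgebra ℝ (Pt → ℝ) where
  carrier := {f | ContDiff ℝ ∞ f}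
  mul_mem' {f g} (hf : ContDiff ℝ ∞ f) (hg : ContDiff ℝ ∞ g) := hf.mul hg
  add_mem' {f g} (hf : ContDiff ℝ ∞ f) (hg : ContDiff ℝ ∞ g) := hf.add hg
  algebraMap_mem' c := show ContDiff ℝ ∞ fun _ => c from contDiff_const

/-- Smooth functions on `ℝ³`. -/
abbrev Sm : Type := smoothAlg

theorem Sm.contDiff (f : Sm) : ContDiff ℝ ∞ f.1 := f.2

theorem Sm.differentiable (f : Sm) : Differentiable ℝ f.1 := f.contDiff.differentiable (by simp)

theorem contDiff_pd (i : Fin 3) {f : Pt → ℝ} (hf : ContDiff ℝ ∞ f) : ContDiff ℝ ∞ (pd i f) :=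
  (hf.fderiv_right (m := ∞) (by simp)).clm_apply contDiff_const

/-- The partial derivatives, as derivations of the algebra of smooth functions. -/
def pdS (i : Fin 3) : Derivation ℝ Sm Sm :=
  Derivation.mk'
    { toFun := fun f => ⟨pd i f.1, contDiff_pd i f.2⟩
      map_add' := fun f g => by
        ext p
        simp [pd, fderiv_add (f.differentiable p) (g.differentiable p)]
      map_smul' := fun c f => by
        ext p
        simp [pd, fderiv_const_smul (f.differentiable p)] }
    (fun f g => by
      ext p
      simp [pd, fderiv_mul (f.differentiable p) (g.differentiable p)])

theorem pdS_apply (i : Fin 3) (f : Sm) (p : Pt) : (pdS i f).1 p = pd i f.1 p := rfl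

theorem pdS_comm (i j : Fin 3) (f : Sm) : pdS i (pdS j f) = pdS j (pdS i f) := by
  ext p
  have key : ∀ i j : Fin 3, pd i (pd j f.1) p
      = fderiv ℝ (fderiv ℝ f.1) p (Pi.single i 1) (Pi.single j 1) := by
    intro i j
    have h : DifferentiableAt ℝ (fderiv ℝ f.1) p :=
      ((f.contDiff.fderiv_right (m := ∞) (by simp)).differentiable (by simp)) p
    simp only [pd]
    change fderiv ℝ (fun q => fderiv ℝ f.1 q (Pi.single j 1)) p _ = _
    rw [fderiv_clm_apply h (by fun_prop)]
    simp
  change pd i (pd j f.1) p = pd j (pd i f.1) p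
  rw [key, key]
  exact (f.contDiff.contDiffAt.isSymmSndFDerivAt
    (by simpa using (WithTop.coe_le_coe.mpr le_top : ((2 : ℕ∞) : WithTop ℕ∞) ≤ ∞))) _ _

/-- The coordinate functions on `ℝ³`. -/
def coord (i : Fin 3) : Sm :=
  ⟨fun p => p i, show ContDiff ℝ ∞ fun p : Pt => p i from contDiff_apply ℝ ℝ i⟩

@[simp] theorem coord_apply (i : Fin 3) (p : Pt) : (coord i).1 p = p i := rfl

theorem pdS_coord (i j : Fin 3) : pdS i (coord j) = if i = j then 1 else 0 := by
  ext p
  change fderiv ℝ (fun p : Pt => p j) p (Pi.single i 1) = _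
  rw [(hasFDerivAt_apply j p).fderiv]
  by_cases h : i = j
  · subst h; simp
  · simp [h, Ne.symm h]

/-! ### The left-invariant frame of the Heisenberg group -/

/-- The left-invariant field `X = ∂/∂x + 2y ∂/∂t`, as a derivation. -/
def opX : Derivation ℝ Sm Sm := pdS 0 + (2 * coord 1) • pdS 2

/-- The left-invariant field `Y = ∂/∂y - 2x ∂/∂t`, as a derivation. -/
def opY : Derivation ℝ Sm Sm := pdS 1 - (2 * coord 0) • pdS 2

/-- The central field `∂/∂t`, as a derivation. -/
def opT : Derivation ℝ Sm Sm := pdS 2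

theorem opX_eq (f : Sm) : opX f = pdS 0 f + 2 * coord 1 * pdS 2 f := by
  simp [opX]

theorem opY_eq (f : Sm) : opY f = pdS 1 f - 2 * coord 0 * pdS 2 f := by
  simp [opY]

theorem pdS_zero_eq (f : Sm) : pdS 0 f = opX f - 2 * coord 1 * opT f := by
  rw [opX_eq, opT]; ring

theorem pdS_one_eq (f : Sm) : pdS 1 f = opY f + 2 * coord 0 * opT f := by
  rw [opY_eq, opT]; ring

theorem pdS_two_eq (f : Sm) : pdS 2 f = opT f := rfl

@[simp] theorem opX_x : opX (coord 0) = 1 := by simp [opX_eq, pdS_coord]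
@[simp] theorem opX_y : opX (coord 1) = 0 := by simp [opX_eq, pdS_coord]
@[simp] theorem opX_t : opX (coord 2) = 2 * coord 1 := by simp [opX_eq, pdS_coord]
@[simp] theorem opY_x : opY (coord 0) = 0 := by simp [opY_eq, pdS_coord]
@[simp] theorem opY_y : opY (coord 1) = 1 := by simp [opY_eq, pdS_coord]
@[simp] theorem opY_t : opY (coord 2) = -(2 * coord 0) := by simp [opY_eq, pdS_coord]
@[simp] theorem opT_x : opT (coord 0) = 0 := by simp [opT, pdS_coord]
@[simp] theorem opT_y : opT (coord 1) = 0 := by simp [opT, pdS_coord]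
@[simp] theorem opT_t : opT (coord 2) = 1 := by simp [opT, pdS_coord]

theorem derivation_ofNat (D : Derivation ℝ Sm Sm) (n : ℕ) [n.AtLeastTwo] :
    D (ofNat(n) : Sm) = 0 := by
  rw [← Nat.cast_ofNat (R := Sm)]
  exact D.map_natCast n

theorem derivation_mul (D : Derivation ℝ Sm Sm) (f g : Sm) : D (f * g) = f * D g + g * D f := by
  simp [D.leibniz]

theorem opX_opT (f : Sm) : opX (opT f) = opT (opX f) := by
  simp [opX_eq, opT, derivation_ofNat, pdS_coord, pdS_comm 0 2]

theorem opY_opT (f : Sm) : opY (opT f) = opT (opY f) := by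
  simp [opY_eq, opT, derivation_ofNat, pdS_coord, pdS_comm 1 2]

/-- The Heisenberg commutation relation; every integrability condition below comes from it. -/
theorem opY_opX (f : Sm) : opY (opX f) = opX (opY f) + 4 * opT f := by
  simp only [opX_eq, opY_eq, opT, derivation_mul, derivation_ofNat, pdS_coord, pdS_comm 1 0,
    pdS_comm 1 2, pdS_comm 2 0, map_add, map_sub]
  simp
  ring

/-- The Kohn Laplacian is `X² + Y²`. -/
theorem kohnLaplacian_eq (f : Sm) (p : Pt) :
    kohnLaplacian f.1 p = (opX (opX f) + opY (opY f)).1 p := by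
  have h : opX (opX f) + opY (opY f) = pdS 0 (pdS 0 f) + pdS 1 (pdS 1 f)
      + 4 * (coord 0 ^ 2 + coord 1 ^ 2) * pdS 2 (pdS 2 f) + 4 * coord 1 * pdS 0 (pdS 2 f)
      - 4 * coord 0 * pdS 1 (pdS 2 f) := by
    simp only [opX_eq, opY_eq, derivation_mul, derivation_ofNat, pdS_coord,
      pdS_comm 2 1, pdS_comm 2 0, map_add, map_sub]
    simp
    ring
  rw [h]
  rfl

/-- The horizontal fields are bracket-generating: `Tf` is a quarter of `[Y, X]f`, so the whole
gradient vanishes. -/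
theorem Sm.eq_apply_zero_of_opX_opY (f : Sm) (hX : opX f = 0) (hY : opY f = 0) :
    ∀ p, f.1 p = f.1 0 := by
  have hT : opT f = 0 := by
    have h := opY_opX f
    rw [hX, hY, map_zero, map_zero, zero_add] at h
    have h4 : (4 : ℝ) • opT f = 0 := by
      rw [Algebra.smul_def, map_ofNat]; exact h.symm
    exact (smul_eq_zero.mp h4).resolve_left (by norm_num)
  have hpd : ∀ i, pdS i f = 0 := by
    intro i
    fin_cases i
    · simp [pdS_zero_eq, hX, hT]
    · simp [pdS_one_eq, hY, hT]
    · exact hT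
  have hf : ∀ p, fderiv ℝ f.1 p = 0 := by
    intro p
    ext v
    have hv : v = ∑ i, v i • (Pi.single i (1 : ℝ) : Pt) := by
      ext j; simp [Finset.sum_apply, Pi.single_apply]
    rw [hv, map_sum]
    refine (Finset.sum_eq_zero fun i _ => ?_).trans (by simp)
    rw [map_smul]
    have h := congrArg (fun g : Sm => g.1 p) (hpd i)
    change pd i f.1 p = 0 at h
    rw [← pd, h, smul_zero]
  intro p
  exact is_const_of_fderiv_eq_zero f.differentiable hf p 0

theorem Sm.eq_of_natCast_mul_eq (n : ℕ) (hn : n ≠ 0) {f g : Sm} (hf : (n : Sm) * f = n * g) :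
    f = g := by
  rw [← sub_eq_zero]
  refine (smul_eq_zero.mp (?_ : (n : ℝ) • (f - g) = 0)).resolve_left (by exact_mod_cast hn)
  rw [Algebra.smul_def]
  simp only [map_natCast]
  linear_combination hf

/-! ### Contact potentials: an overdetermined system of finite type -/

/-- The equations `X²h = Y²h`, `XYh + YXh = 0` for the generating function of a conformal contact
field. -/
structure IsContactPotential (h : Sm) : Prop where
  eqXX : opX (opX h) = opY (opY h)
  eqXY : opX (opY h) + opY (opX h) = 0

namespace IsContactPotential

/-- The system gives the sum of `XYh` and `YXh`, the commutator gives their difference. -/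
theorem XY {h : Sm} (H : IsContactPotential h) : opX (opY h) = -(2 * opT h) := by
  apply Sm.eq_of_natCast_mul_eq 2 (by norm_num)
  have h1 := opY_opX h
  have h2 := H.eqXY
  push_cast
  linear_combination h2 - h1

theorem YX {h : Sm} (H : IsContactPotential h) : opY (opX h) = 2 * opT h := by
  rw [opY_opX, H.XY]; ring

theorem YY {h : Sm} (H : IsContactPotential h) : opY (opY h) = opX (opX h) := H.eqXX.symm

theorem YXX {h : Sm} (H : IsContactPotential h) : opY (opX (opX h)) = 6 * opT (opX h) := by
  have h1 := opY_opX (opX h)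
  rw [H.YX, derivation_mul, derivation_ofNat, opX_opT] at h1
  linear_combination h1

theorem XXX {h : Sm} (H : IsContactPotential h) : opX (opX (opX h)) = -(6 * opT (opY h)) := by
  have h1 := opY_opX (opY h)
  rw [H.XY, map_neg, derivation_mul, derivation_ofNat, opY_opT, H.YY] at h1
  linear_combination -h1

/-- Compatibility of `XXX` and `YXX`: applying `[Y, X] = 4T` to `X²h` yields `-6 TX²h = 6 TX²h + 4
TX²h`. Differentiating the result along `X` and `Y` gives `TTY` and `TTX`. -/
theorem TXX {h : Sm} (H : IsContactPotential h) : opT (opX (opX h)) = 0 := by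
  have h1 := opY_opX (opX (opX h))
  rw [H.XXX, H.YXX, map_neg, derivation_mul, derivation_ofNat, derivation_mul, derivation_ofNat,
    opY_opT, opX_opT, H.YY] at h1
  apply Sm.eq_of_natCast_mul_eq 16 (by norm_num)
  push_cast
  linear_combination -h1

theorem TTY {h : Sm} (H : IsContactPotential h) : opT (opT (opY h)) = 0 := by
  have h1 := congrArg opX H.TXX
  rw [opX_opT, H.XXX, map_neg, derivation_mul, derivation_ofNat, map_zero] at h1
  apply Sm.eq_of_natCast_mul_eq 6 (by norm_num)
  push_cast
  linear_combination -h1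

theorem TTX {h : Sm} (H : IsContactPotential h) : opT (opT (opX h)) = 0 := by
  have h1 := congrArg opY H.TXX
  rw [opY_opT, H.YXX, derivation_mul, derivation_ofNat, map_zero] at h1
  apply Sm.eq_of_natCast_mul_eq 6 (by norm_num)
  push_cast
  linear_combination h1

end IsContactPotential

theorem eq_zero_of_opX_opY {f : Sm} (hX : opX f = 0) (hY : opY f = 0) (h0 : f.1 0 = 0) : f = 0 := by
  ext p
  rw [f.eq_apply_zero_of_opX_opY hX hY p, h0]; rfl

/-- Descent from the highest derivatives: in the order `T²h`, `TXh`, `TYh`, `Th`, `X²h`, `Xh`, `Yh`,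
`h`, the horizontal derivatives of each function vanish identically or reduce to functions already
shown to be zero, so its value at the origin decides it. -/
theorem IsContactPotential.eq_zero {h : Sm} (H : IsContactPotential h) (h0 : h.1 0 = 0)
    (hX : (opX h).1 0 = 0) (hY : (opY h).1 0 = 0) (hT : (opT h).1 0 = 0)
    (hTX : (opT (opX h)).1 0 = 0) (hTY : (opT (opY h)).1 0 = 0) (hTT : (opT (opT h)).1 0 = 0)
    (hXX : (opX (opX h)).1 0 = 0) : h = 0 := by
  have eTT : opT (opT h) = 0 := eq_zero_of_opX_opY
    (by rw [opX_opT, opX_opT, H.TTX]) (by rw [opY_opT, opY_opT, H.TTY]) hTT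
  have eTX : opT (opX h) = 0 := eq_zero_of_opX_opY
    (by rw [opX_opT, H.TXX])
    (by rw [opY_opT, H.YX, derivation_mul, derivation_ofNat, eTT]; simp) hTX
  have eTY : opT (opY h) = 0 := eq_zero_of_opX_opY
    (by rw [opX_opT, H.XY, map_neg, derivation_mul, derivation_ofNat, eTT]; simp)
    (by rw [opY_opT, H.YY, H.TXX]) hTY
  have eT : opT h = 0 := eq_zero_of_opX_opY (by rw [opX_opT, eTX]) (by rw [opY_opT, eTY]) hT
  have eXX : opX (opX h) = 0 := eq_zero_of_opX_opY
    (by rw [H.XXX, eTY]; simp) (by rw [H.YXX, eTX]; simp) hXX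
  have eX : opX h = 0 := eq_zero_of_opX_opY eXX (by rw [H.YX, eT]; simp) hX
  have eY : opY h = 0 := eq_zero_of_opX_opY (by rw [H.XY, eT]; simp) (by rw [H.YY, eXX]) hY
  exact eq_zero_of_opX_opY eX eY h0

/-! ### Calculus of differential functions -/

/-- The restriction of a jet to finitely many jet coordinates. -/
def restr (s : Finset MIdx) (z : Jet) : Pt × (s → ℝ) := (z.1, fun α => z.2 α)

/-- The direction of the total derivative `D_i` at a jet. -/
def totalDir (i : Fin 3) (z : Jet) : Jet := (Pi.single i 1, fun α => z.2 (α + e i))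

/-- The jet space is an infinite product without a norm, so differentiation is along lines only,
where it reduces to the Fréchet derivative of the finite-dimensional factor `g`. -/
theorem hasLineDerivAt_of_factor {s : Finset MIdx} {g : Pt × (s → ℝ) → ℝ} (hg : ContDiff ℝ ∞ g)
    {P : Jet → ℝ} (hP : ∀ z : Jet, P z = g (restr s z)) (z v : Jet) :
    HasLineDerivAt ℝ P (fderiv ℝ g (restr s z) (restr s v)) z v := by
  have h := ((hg.differentiable (by simp)) (restr s z)).hasFDerivAt.hasLineDerivAt (restr s v)
  have e : (fun t : ℝ => P (z + t • v)) = fun t : ℝ => g (restr s z + t • restr s v) := by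
    funext t; rw [hP]; rfl
  unfold HasLineDerivAt at h ⊢
  rw [e]
  exact h

theorem partialX_of_factor {s : Finset MIdx} {g : Pt × (s → ℝ) → ℝ} (hg : ContDiff ℝ ∞ g)
    {P : Jet → ℝ} (hP : ∀ z : Jet, P z = g (restr s z)) (i : Fin 3) (z : Jet) :
    partialX i P z = fderiv ℝ g (restr s z) (Pi.single i 1, 0) := by
  have h := hasLineDerivAt_of_factor hg hP z (Pi.single i 1, 0)
  have h2 : HasDerivAt (fun r : ℝ => P (Function.update z.1 i r, z.2))
      (fderiv ℝ g (restr s z) (Pi.single i 1, 0)) (z.1 i) := by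
    unfold HasLineDerivAt at h
    rw [← sub_self (z.1 i)] at h
    have h3 := h.comp_sub_const (z.1 i) (z.1 i)
    refine h3.congr_of_eventuallyEq (Filter.Eventually.of_forall fun r => ?_)
    change P _ = P _
    congr 1
    refine Prod.ext ?_ (by simp)
    ext j
    by_cases hj : j = i
    · subst hj; simp
    · simp [hj]
  exact h2.deriv

theorem partialU_of_factor {s : Finset MIdx} {g : Pt × (s → ℝ) → ℝ} (hg : ContDiff ℝ ∞ g)
    {P : Jet → ℝ} (hP : ∀ z : Jet, P z = g (restr s z)) (α : MIdx) (z : Jet) :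
    partialU α P z = fderiv ℝ g (restr s z) (restr s (0, Pi.single α 1)) := by
  have h := hasLineDerivAt_of_factor hg hP z (0, Pi.single α 1)
  have h2 : HasDerivAt (fun r : ℝ => P (z.1, Function.update z.2 α r))
      (fderiv ℝ g (restr s z) (restr s (0, Pi.single α 1))) (z.2 α) := by
    unfold HasLineDerivAt at h
    rw [← sub_self (z.2 α)] at h
    have h3 := h.comp_sub_const (z.2 α) (z.2 α)
    refine h3.congr_of_eventuallyEq (Filter.Eventually.of_forall fun r => ?_)
    change P _ = P _
    congr 1
    refine Prod.ext (by simp) ?_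
    ext j
    by_cases hj : j = α
    · subst hj; simp
    · simp [hj]
  exact h2.deriv

/-- Only the coordinates in `s` contribute to the infinite sum, and by linearity the remaining terms
assemble into one directional derivative. The sum and product rules for `totalD` then follow from
one-variable calculus and uniqueness of derivatives. -/
theorem totalD_of_factor {s : Finset MIdx} {g : Pt × (s → ℝ) → ℝ} (hg : ContDiff ℝ ∞ g)
    {P : Jet → ℝ} (hP : ∀ z : Jet, P z = g (restr s z)) (i : Fin 3) (z : Jet) :
    totalD i P z = fderiv ℝ g (restr s z) (restr s (totalDir i z)) := by
  have hsum : ∑ᶠ α : MIdx, z.2 (α + e i) * partialU α P z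
      = ∑ α ∈ s, z.2 (α + e i) * partialU α P z := by
    refine finsum_eq_sum_of_support_subset _ fun α hα => ?_
    by_contra hs
    apply hα
    have : restr s (0, Pi.single α 1) = 0 := by
      refine Prod.ext rfl ?_
      ext β
      have : (β : MIdx) ≠ α := fun h => hs (by rw [← h]; exact β.2)
      simp [restr, this]
    change z.2 (α + e i) * partialU α P z = 0
    rw [partialU_of_factor hg hP, this, map_zero, mul_zero]
  rw [totalD, hsum, partialX_of_factor hg hP]
  have hv : restr s (totalDir i z) = (Pi.single i 1, 0)
      + ∑ α ∈ s, z.2 (α + e i) • restr s (0, Pi.single α 1) := by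
    refine Prod.ext ?_ ?_
    · simp [restr, totalDir, Prod.fst_sum]
    · ext β
      simp [restr, totalDir, Prod.snd_sum, Pi.single_apply]
  rw [hv, map_add, map_sum]
  congr 1
  refine Finset.sum_congr rfl fun α _ => ?_
  rw [map_smul, partialU_of_factor hg hP, smul_eq_mul]

theorem IsDifferentialFunction.hasLineDerivAt_totalD {P : Jet → ℝ} (hP : IsDifferentialFunction P)
    (i : Fin 3) (z : Jet) : HasLineDerivAt ℝ P (totalD i P z) z (totalDir i z) := by
  obtain ⟨s, g, hg, hPg⟩ := hP
  rw [totalD_of_factor hg hPg]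
  exact hasLineDerivAt_of_factor hg hPg z _

theorem IsDifferentialFunction.comp₂ {P Q : Jet → ℝ} (hP : IsDifferentialFunction P)
    (hQ : IsDifferentialFunction Q) {f : ℝ × ℝ → ℝ} (hf : ContDiff ℝ ∞ f) :
    IsDifferentialFunction fun z => f (P z, Q z) := by
  classical
  obtain ⟨s, g, hg, hPg⟩ := hP
  obtain ⟨s', g', hg', hQg⟩ := hQ
  refine ⟨s ∪ s', fun q => f (g (q.1, fun α => q.2 ⟨α, Finset.mem_union_left _ α.2⟩),
    g' (q.1, fun α => q.2 ⟨α, Finset.mem_union_right _ α.2⟩)), ?_, fun z => ?_⟩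
  · refine hf.comp ((hg.comp ?_).prodMk (hg'.comp ?_))
    · fun_prop
    · fun_prop
  · simp [hPg, hQg]

theorem IsDifferentialFunction.add {P Q : Jet → ℝ} (hP : IsDifferentialFunction P)
    (hQ : IsDifferentialFunction Q) : IsDifferentialFunction fun z => P z + Q z :=
  hP.comp₂ hQ (f := fun p => p.1 + p.2) (by fun_prop)

theorem IsDifferentialFunction.sub {P Q : Jet → ℝ} (hP : IsDifferentialFunction P)
    (hQ : IsDifferentialFunction Q) : IsDifferentialFunction fun z => P z - Q z :=
  hP.comp₂ hQ (f := fun p => p.1 - p.2) (by fun_prop)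

theorem IsDifferentialFunction.mul {P Q : Jet → ℝ} (hP : IsDifferentialFunction P)
    (hQ : IsDifferentialFunction Q) : IsDifferentialFunction fun z => P z * Q z :=
  hP.comp₂ hQ (f := fun p => p.1 * p.2) (by fun_prop)

theorem isDifferentialFunction_const (c : ℝ) : IsDifferentialFunction fun _ => c :=
  ⟨∅, fun _ => c, contDiff_const, fun _ => rfl⟩

theorem isDifferentialFunction_coord (α : MIdx) : IsDifferentialFunction fun z => z.2 α :=
  ⟨{α}, fun q => q.2 ⟨α, Finset.mem_singleton_self α⟩, by fun_prop, fun _ => rfl⟩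

theorem IsDifferentialFunction.sum {ι : Type*} (s : Finset ι) {P : ι → Jet → ℝ}
    (hP : ∀ j, IsDifferentialFunction (P j)) : IsDifferentialFunction fun z => ∑ j ∈ s, P j z := by
  classical
  induction s using Finset.induction_on with
  | empty => simpa using isDifferentialFunction_const 0
  | insert j s hj ih => simpa [Finset.sum_insert hj] using (hP j).add ih

theorem totalD_add {P Q : Jet → ℝ} (hP : IsDifferentialFunction P)
    (hQ : IsDifferentialFunction Q) (i : Fin 3) (z : Jet) :
    totalD i (fun z => P z + Q z) z = totalD i P z + totalD i Q z :=
  ((hP.add hQ).hasLineDerivAt_totalD i z).unique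
    (HasDerivAt.add (hP.hasLineDerivAt_totalD i z) (hQ.hasLineDerivAt_totalD i z))

theorem totalD_sub {P Q : Jet → ℝ} (hP : IsDifferentialFunction P)
    (hQ : IsDifferentialFunction Q) (i : Fin 3) (z : Jet) :
    totalD i (fun z => P z - Q z) z = totalD i P z - totalD i Q z :=
  ((hP.sub hQ).hasLineDerivAt_totalD i z).unique
    (HasDerivAt.sub (hP.hasLineDerivAt_totalD i z) (hQ.hasLineDerivAt_totalD i z))

theorem totalD_mul {P Q : Jet → ℝ} (hP : IsDifferentialFunction P)
    (hQ : IsDifferentialFunction Q) (i : Fin 3) (z : Jet) :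
    totalD i (fun z => P z * Q z) z = totalD i P z * Q z + P z * totalD i Q z := by
  have h := HasDerivAt.mul (hP.hasLineDerivAt_totalD i z) (hQ.hasLineDerivAt_totalD i z)
  simp only [zero_smul, add_zero] at h
  exact ((hP.mul hQ).hasLineDerivAt_totalD i z).unique h

theorem totalD_sum {ι : Type*} (s : Finset ι) {P : ι → Jet → ℝ}
    (hP : ∀ j, IsDifferentialFunction (P j)) (i : Fin 3) (z : Jet) :
    totalD i (fun z => ∑ j ∈ s, P j z) z = ∑ j ∈ s, totalD i (P j) z := by
  have h := HasDerivAt.fun_sum (u := s) fun j _ => (hP j).hasLineDerivAt_totalD i z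
  exact ((IsDifferentialFunction.sum s hP).hasLineDerivAt_totalD i z).unique h

theorem totalD_coord (α : MIdx) (i : Fin 3) (z : Jet) :
    totalD i (fun z => z.2 α) z = z.2 (α + e i) := by
  refine ((isDifferentialFunction_coord α).hasLineDerivAt_totalD i z).unique ?_
  have h : HasDerivAt (fun r : ℝ => z.2 α + r * z.2 (α + e i)) (z.2 (α + e i)) 0 := by
    simpa using ((hasDerivAt_id (0 : ℝ)).mul_const (z.2 (α + e i))).const_add (z.2 α)
  exact h

/-- A function of `x, y, t, u` as a function on the jet space. -/
def lift (f : Pt × ℝ → ℝ) (z : Jet) : ℝ := f (z.1, z.2 0)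

/-- The partial derivative of a function of `x, y, t, u` in the `i`-th base variable. -/
def dX (i : Fin 3) (f : Pt × ℝ → ℝ) (q : Pt × ℝ) : ℝ := fderiv ℝ f q (Pi.single i 1, 0)

/-- The partial derivative of a function of `x, y, t, u` in `u`. -/
def dU (f : Pt × ℝ → ℝ) (q : Pt × ℝ) : ℝ := fderiv ℝ f q (0, 1)

theorem contDiff_dX (i : Fin 3) {f : Pt × ℝ → ℝ} (hf : ContDiff ℝ ∞ f) : ContDiff ℝ ∞ (dX i f) :=
  (hf.fderiv_right (m := ∞) (by simp)).clm_apply contDiff_const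

theorem contDiff_dU {f : Pt × ℝ → ℝ} (hf : ContDiff ℝ ∞ f) : ContDiff ℝ ∞ (dU f) :=
  (hf.fderiv_right (m := ∞) (by simp)).clm_apply contDiff_const

theorem isDifferentialFunction_lift {f : Pt × ℝ → ℝ} (hf : ContDiff ℝ ∞ f) :
    IsDifferentialFunction (lift f) :=
  ⟨{0}, fun q => f (q.1, q.2 ⟨0, Finset.mem_singleton_self 0⟩), hf.comp (by fun_prop), fun _ => rfl⟩

theorem totalD_lift {f : Pt × ℝ → ℝ} (hf : ContDiff ℝ ∞ f) (i : Fin 3) (z : Jet) :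
    totalD i (lift f) z = lift (dX i f) z + z.2 (e i) * lift (dU f) z := by
  refine ((isDifferentialFunction_lift hf).hasLineDerivAt_totalD i z).unique ?_
  have h := ((hf.differentiable (by simp)) (z.1, z.2 0)).hasFDerivAt.hasLineDerivAt
    (Pi.single i 1, z.2 (0 + e i))
  have hv : ((Pi.single i 1, z.2 (0 + e i)) : Pt × ℝ)
      = (Pi.single i 1, 0) + z.2 (e i) • ((0, 1) : Pt × ℝ) := by
    simp
  have h' : fderiv ℝ f (z.1, z.2 0) (Pi.single i 1, z.2 (0 + e i))
      = lift (dX i f) z + z.2 (e i) * lift (dU f) z := by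
    rw [hv, map_add, map_smul]; rfl
  rw [h'] at h
  exact h

/-! ### The extensions of a vector field -/

/-- The component `ξⁱ` of a vector field. -/
def base (S : VField) (i : Fin 3) (q : Pt × ℝ) : ℝ := (S q).1 i

/-- The component `η` of a vector field. -/
def fib (S : VField) (q : Pt × ℝ) : ℝ := (S q).2

theorem contDiff_base {S : VField} (hS : ContDiff ℝ ∞ S) (i : Fin 3) : ContDiff ℝ ∞ (base S i) :=
  (contDiff_pi.mp hS.fst) i

theorem contDiff_fib {S : VField} (hS : ContDiff ℝ ∞ S) : ContDiff ℝ ∞ (fib S) := hS.snd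

theorem xi_eq (S : VField) (i : Fin 3) : xi S i = lift (base S i) := rfl

theorem eta_eq (S : VField) : eta S = lift (fib S) := rfl

theorem eta1_eq {S : VField} (hS : ContDiff ℝ ∞ S) (i : Fin 3) :
    eta1 S i = fun z => lift (dX i (fib S)) z + z.2 (e i) * lift (dU (fib S)) z
      - ∑ j, (lift (dX i (base S j)) z + z.2 (e i) * lift (dU (base S j)) z) * z.2 (e j) := by
  funext z
  simp only [eta1, xi_eq, eta_eq, totalD_lift (contDiff_fib hS), totalD_lift (contDiff_base hS _)]

theorem eta2_eq {S : VField} (hS : ContDiff ℝ ∞ S) (i j : Fin 3) (z : Jet) :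
    eta2 S i j z = lift (dX j (dX i (fib S))) z + z.2 (e j) * lift (dU (dX i (fib S))) z
      + z.2 (e i + e j) * lift (dU (fib S)) z
      + z.2 (e i) * (lift (dX j (dU (fib S))) z + z.2 (e j) * lift (dU (dU (fib S))) z)
      - ∑ l, ((lift (dX j (dX i (base S l))) z + z.2 (e j) * lift (dU (dX i (base S l))) z
          + z.2 (e i + e j) * lift (dU (base S l)) z
          + z.2 (e i) * (lift (dX j (dU (base S l))) z + z.2 (e j) * lift (dU (dU (base S l))) z))
            * z.2 (e l)
        + (lift (dX i (base S l)) z + z.2 (e i) * lift (dU (base S l)) z) * z.2 (e l + e j))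
      - ∑ l, (lift (dX j (base S l)) z + z.2 (e j) * lift (dU (base S l)) z) * z.2 (e i + e l) := by
  have c := fun α => isDifferentialFunction_coord α
  have f0 := contDiff_fib hS
  have f1 := contDiff_dX i f0
  have f2 := contDiff_dU f0
  have b0 := fun l => contDiff_base hS l
  have b1 := fun l => contDiff_dX i (b0 l)
  have b2 := fun l => contDiff_dU (b0 l)
  have L := @isDifferentialFunction_lift
  have hb := fun l => (L (b1 l)).add ((c (e i)).mul (L (b2 l)))
  simp only [eta2, eta1_eq hS, xi_eq]
  rw [totalD_sub ((L f1).add ((c _).mul (L f2))) (.sum _ fun l => (hb l).mul (c (e l))),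
    totalD_add (L f1) ((c _).mul (L f2)), totalD_mul (c _) (L f2), totalD_lift f1, totalD_lift f2,
    totalD_coord, totalD_sum _ fun l => (hb l).mul (c (e l))]
  simp only [totalD_mul (hb _) (c (e _)), totalD_add (L (b1 _)) ((c (e i)).mul (L (b2 _))),
    totalD_mul (c (e i)) (L (b2 _)), totalD_lift (b1 _), totalD_lift (b2 _), totalD_lift (b0 _),
    totalD_coord]
  ring_nf

theorem e_add_ne_e (i j k : Fin 3) : e i + e j ≠ e k := fun h => by
  have := congrArg Finsupp.degree h
  simp at this

theorem e_add_eq (i j k l : Fin 3) :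
    e i + e j = e k + e l ↔ (i = k ∧ j = l) ∨ (i = l ∧ j = k) := by
  rw [Finsupp.ext_iff]
  fin_cases i <;> fin_cases j <;> fin_cases k <;> fin_cases l <;>
    simp [Fin.forall_fin_succ]

/-- The equation and the Lagrangian have degree at most two in each single coordinate, so this
covers all their partial derivatives. -/
theorem deriv_quadratic {f : ℝ → ℝ} (a b c : ℝ) (hf : ∀ r, f r = a * r ^ 2 + b * r + c) (r : ℝ) :
    deriv f r = 2 * a * r + b := by
  have h : HasDerivAt (fun r => a * r ^ 2 + b * r + c) (a * (2 * r) + b * 1) r := by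
    simpa using (((hasDerivAt_pow 2 r).const_mul a).add ((hasDerivAt_id r).const_mul b)).add_const c
  rw [funext hf, h.deriv]
  ring

theorem prolong1_kohnLagrangian (S : VField) (z : Jet) :
    prolong1 S kohnLagrangian z =
      xi S 0 z * (4 * z.1 0 * z.2 (e 2) ^ 2 - 2 * z.2 (e 1) * z.2 (e 2))
      + xi S 1 z * (4 * z.1 1 * z.2 (e 2) ^ 2 + 2 * z.2 (e 0) * z.2 (e 2))
      + eta1 S 0 z * (z.2 (e 0) + 2 * z.1 1 * z.2 (e 2))
      + eta1 S 1 z * (z.2 (e 1) - 2 * z.1 0 * z.2 (e 2))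
      + eta1 S 2 z * (4 * (z.1 0 ^ 2 + z.1 1 ^ 2) * z.2 (e 2) + 2 * z.1 1 * z.2 (e 0)
        - 2 * z.1 0 * z.2 (e 1)) := by
  have x0 : partialX 0 kohnLagrangian z = 4 * z.1 0 * z.2 (e 2) ^ 2 - 2 * z.2 (e 1) * z.2 (e 2) :=
    (deriv_quadratic (2 * z.2 (e 2) ^ 2) (-2 * z.2 (e 1) * z.2 (e 2))
      (z.2 (e 0) ^ 2 / 2 + z.2 (e 1) ^ 2 / 2 + 2 * z.1 1 ^ 2 * z.2 (e 2) ^ 2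
        + 2 * z.1 1 * z.2 (e 0) * z.2 (e 2))
      (fun r => by simp [kohnLagrangian]; ring) _).trans (by ring)
  have x1 : partialX 1 kohnLagrangian z = 4 * z.1 1 * z.2 (e 2) ^ 2 + 2 * z.2 (e 0) * z.2 (e 2) :=
    (deriv_quadratic (2 * z.2 (e 2) ^ 2) (2 * z.2 (e 0) * z.2 (e 2))
      (z.2 (e 0) ^ 2 / 2 + z.2 (e 1) ^ 2 / 2 + 2 * z.1 0 ^ 2 * z.2 (e 2) ^ 2
        - 2 * z.1 0 * z.2 (e 1) * z.2 (e 2))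
      (fun r => by simp [kohnLagrangian]; ring) _).trans (by ring)
  have x2 : partialX 2 kohnLagrangian z = 0 :=
    (deriv_quadratic 0 0 (kohnLagrangian z) (fun r => by simp [kohnLagrangian]) _).trans (by ring)
  have u : partialU 0 kohnLagrangian z = 0 :=
    (deriv_quadratic 0 0 (kohnLagrangian z) (fun r => by simp [kohnLagrangian]) _).trans (by ring)
  have u0 : partialU (e 0) kohnLagrangian z = z.2 (e 0) + 2 * z.1 1 * z.2 (e 2) :=
    (deriv_quadratic (1 / 2) (2 * z.1 1 * z.2 (e 2))
      (z.2 (e 1) ^ 2 / 2 + 2 * (z.1 0 ^ 2 + z.1 1 ^ 2) * z.2 (e 2) ^ 2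
        - 2 * z.1 0 * z.2 (e 1) * z.2 (e 2))
      (fun r => by simp [kohnLagrangian, Finsupp.single_left_inj]; ring)
      _).trans (by ring)
  have u1 : partialU (e 1) kohnLagrangian z = z.2 (e 1) - 2 * z.1 0 * z.2 (e 2) :=
    (deriv_quadratic (1 / 2) (-2 * z.1 0 * z.2 (e 2))
      (z.2 (e 0) ^ 2 / 2 + 2 * (z.1 0 ^ 2 + z.1 1 ^ 2) * z.2 (e 2) ^ 2
        + 2 * z.1 1 * z.2 (e 0) * z.2 (e 2))
      (fun r => by simp [kohnLagrangian, Finsupp.single_left_inj]; ring)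
      _).trans (by ring)
  have u2 : partialU (e 2) kohnLagrangian z = 4 * (z.1 0 ^ 2 + z.1 1 ^ 2) * z.2 (e 2)
      + 2 * z.1 1 * z.2 (e 0) - 2 * z.1 0 * z.2 (e 1) :=
    (deriv_quadratic (2 * (z.1 0 ^ 2 + z.1 1 ^ 2)) (2 * z.1 1 * z.2 (e 0) - 2 * z.1 0 * z.2 (e 1))
      (z.2 (e 0) ^ 2 / 2 + z.2 (e 1) ^ 2 / 2)
      (fun r => by simp [kohnLagrangian, Finsupp.single_left_inj]; ring)
      _).trans (by ring)
  simp only [prolong1, Fin.sum_univ_three, x0, x1, x2, u, u0, u1, u2]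
  ring

theorem prolong2_kohnEq (S : VField) (z : Jet) :
    prolong2 S kohnEq z =
      xi S 0 z * (8 * z.1 0 * z.2 (e 2 + e 2) - 4 * z.2 (e 1 + e 2))
      + xi S 1 z * (8 * z.1 1 * z.2 (e 2 + e 2) + 4 * z.2 (e 0 + e 2))
      + eta2 S 0 0 z + eta2 S 1 1 z + 4 * (z.1 0 ^ 2 + z.1 1 ^ 2) * eta2 S 2 2 z
      + 4 * z.1 1 * eta2 S 0 2 z - 4 * z.1 0 * eta2 S 1 2 z := by
  have x0 : partialX 0 kohnEq z = 8 * z.1 0 * z.2 (e 2 + e 2) - 4 * z.2 (e 1 + e 2) :=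
    (deriv_quadratic (4 * z.2 (e 2 + e 2)) (-4 * z.2 (e 1 + e 2))
      (z.2 (e 0 + e 0) + z.2 (e 1 + e 1) + 4 * z.1 1 ^ 2 * z.2 (e 2 + e 2)
        + 4 * z.1 1 * z.2 (e 0 + e 2))
      (fun r => by simp [kohnEq]; ring) _).trans (by ring)
  have x1 : partialX 1 kohnEq z = 8 * z.1 1 * z.2 (e 2 + e 2) + 4 * z.2 (e 0 + e 2) :=
    (deriv_quadratic (4 * z.2 (e 2 + e 2)) (4 * z.2 (e 0 + e 2))
      (z.2 (e 0 + e 0) + z.2 (e 1 + e 1) + 4 * z.1 0 ^ 2 * z.2 (e 2 + e 2)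
        - 4 * z.1 0 * z.2 (e 1 + e 2))
      (fun r => by simp [kohnEq]; ring) _).trans (by ring)
  have x2 : partialX 2 kohnEq z = 0 :=
    (deriv_quadratic 0 0 (kohnEq z) (fun r => by simp [kohnEq]) _).trans (by ring)
  have u : partialU 0 kohnEq z = 0 :=
    (deriv_quadratic 0 0 (kohnEq z)
      (fun r => by simp [kohnEq]) _).trans (by ring)
  have u1 : ∀ i, partialU (e i) kohnEq z = 0 := fun i =>
    (deriv_quadratic 0 0 (kohnEq z)
      (fun r => by simp [kohnEq, e_add_ne_e]) _).trans (by ring)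
  have u2 : ∀ i j, partialU (e i + e j) kohnEq z
      = (if e 0 + e 0 = e i + e j then 1 else 0) + (if e 1 + e 1 = e i + e j then 1 else 0)
        + 4 * (z.1 0 ^ 2 + z.1 1 ^ 2) * (if e 2 + e 2 = e i + e j then 1 else 0)
        + 4 * z.1 1 * (if e 0 + e 2 = e i + e j then 1 else 0)
        - 4 * z.1 0 * (if e 1 + e 2 = e i + e j then 1 else 0) := by
    intro i j
    suffices h : ∀ B, B = _ → partialU (e i + e j) kohnEq z = B from h _ rfl
    intro B hB
    -- The equation is linear in the jet coordinates: zeroing one coordinate and adding back `r`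
    -- times its indicator exhibits the slope `B`.
    set w : MIdx → ℝ := Function.update z.2 (e i + e j) 0
    refine (deriv_quadratic 0 B (kohnEq (z.1, w)) (fun r => ?_) _).trans (by ring)
    have hw : ∀ α, Function.update z.2 (e i + e j) r α
        = w α + r * if α = e i + e j then 1 else 0 := by
      intro α
      by_cases h : α = e i + e j
      · subst h; simp [w]
      · simp [w, h]
    simp only [kohnEq, hw, hB]
    ring
  have i0 : Finset.Ici (0 : Fin 3) = {0, 1, 2} := by decide
  have i1 : Finset.Ici (1 : Fin 3) = {1, 2} := by decide
  have i2 : Finset.Ici (2 : Fin 3) = {2} := by decide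
  simp only [prolong2, prolong1, Fin.sum_univ_three, x0, x1, x2, u, u1, u2, i0, i1, i2, e_add_eq]
  simp
  ring

/-! ### Fields that are affine in `u` -/

/-- The function `a(x,y,t) u + b(x,y,t)`. -/
def aff (a b : Sm) (q : Pt × ℝ) : ℝ := a.1 q.1 * q.2 + b.1 q.1

theorem contDiff_aff (a b : Sm) : ContDiff ℝ ∞ (aff a b) :=
  ((a.contDiff.comp contDiff_fst).mul contDiff_snd).add (b.contDiff.comp contDiff_fst)

theorem hasFDerivAt_aff (a b : Sm) (q : Pt × ℝ) :
    HasFDerivAt (aff a b)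
      ((a.1 q.1 • ContinuousLinearMap.snd ℝ Pt ℝ
        + q.2 • (fderiv ℝ a.1 q.1).comp (ContinuousLinearMap.fst ℝ Pt ℝ))
        + (fderiv ℝ b.1 q.1).comp (ContinuousLinearMap.fst ℝ Pt ℝ)) q :=
  (((a.differentiable q.1).hasFDerivAt.comp q hasFDerivAt_fst).mul hasFDerivAt_snd).add
    ((b.differentiable q.1).hasFDerivAt.comp q hasFDerivAt_fst)

theorem fderiv_aff (a b : Sm) (q v : Pt × ℝ) :
    fderiv ℝ (aff a b) q v
      = a.1 q.1 * v.2 + q.2 * fderiv ℝ a.1 q.1 v.1 + fderiv ℝ b.1 q.1 v.1 := by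
  rw [(hasFDerivAt_aff a b q).fderiv]
  simp

theorem dX_aff (i : Fin 3) (a b : Sm) : dX i (aff a b) = aff (pdS i a) (pdS i b) := by
  funext q
  simp only [dX, fderiv_aff, aff, pdS_apply, pd]
  ring

theorem dU_aff (a b : Sm) : dU (aff a b) = aff 0 a := by
  funext q
  simp [dU, fderiv_aff, aff]

theorem aff_zero (q : Pt × ℝ) : aff 0 0 q = 0 := by simp [aff]

theorem lift_aff (a b : Sm) (z : Jet) : lift (aff a b) z = a.1 z.1 * z.2 0 + b.1 z.1 := rfl

/-- The field `ξⁱ ∂/∂xⁱ + (a u + b) ∂/∂u` with `ξ, a, b` functions of `x, y, t`. -/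
def projField (ξ : Fin 3 → Sm) (a b : Sm) : VField := fun q => (fun i => (ξ i).1 q.1, aff a b q)

theorem contDiff_projField (ξ : Fin 3 → Sm) (a b : Sm) : ContDiff ℝ ∞ (projField ξ a b) :=
  (contDiff_pi.mpr fun i => (ξ i).contDiff.comp contDiff_fst).prodMk (contDiff_aff a b)

theorem base_projField (ξ : Fin 3 → Sm) (a b : Sm) (i : Fin 3) :
    base (projField ξ a b) i = aff 0 (ξ i) := by
  funext q; simp [base, projField, aff]

theorem fib_projField (ξ : Fin 3 → Sm) (a b : Sm) : fib (projField ξ a b) = aff a b := rfl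

/-- The Kohn Laplacian as an operator on smooth functions. -/
def lap (f : Sm) : Sm := opX (opX f) + opY (opY f)

theorem opX_apply (f : Sm) (p : Pt) : (opX f).1 p = (pdS 0 f).1 p + 2 * p 1 * (pdS 2 f).1 p := by
  rw [opX_eq]; rfl

theorem opY_apply (f : Sm) (p : Pt) : (opY f).1 p = (pdS 1 f).1 p - 2 * p 0 * (pdS 2 f).1 p := by
  rw [opY_eq]; rfl

theorem lap_apply (f : Sm) (p : Pt) : (lap f).1 p = (pdS 0 (pdS 0 f)).1 p + (pdS 1 (pdS 1 f)).1 p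
    + 4 * (p 0 ^ 2 + p 1 ^ 2) * (pdS 2 (pdS 2 f)).1 p + 4 * p 1 * (pdS 0 (pdS 2 f)).1 p
    - 4 * p 0 * (pdS 1 (pdS 2 f)).1 p := by
  rw [lap, ← kohnLaplacian_eq]; rfl

theorem Sm.zero_apply (p : Pt) : (0 : Sm).1 p = 0 := rfl

/-- For these fields the second extension is affine in the jet coordinates, so the determining
equations can be read off coefficient by coefficient. -/
theorem prolong2_projField (ξ : Fin 3 → Sm) (a b : Sm) (z : Jet) :
    prolong2 (projField ξ a b) kohnEq z =
      (ξ 0).1 z.1 * (8 * z.1 0 * z.2 (e 2 + e 2) - 4 * z.2 (e 1 + e 2))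
      + (ξ 1).1 z.1 * (8 * z.1 1 * z.2 (e 2 + e 2) + 4 * z.2 (e 0 + e 2))
      + (lap a).1 z.1 * z.2 0 + (lap b).1 z.1
      + 2 * ((opX a).1 z.1 * (z.2 (e 0) + 2 * z.1 1 * z.2 (e 2))
        + (opY a).1 z.1 * (z.2 (e 1) - 2 * z.1 0 * z.2 (e 2)))
      + a.1 z.1 * kohnEq z - ∑ l, (lap (ξ l)).1 z.1 * z.2 (e l)
      - 2 * ∑ l, ((opX (ξ l)).1 z.1 * (z.2 (e 0 + e l) + 2 * z.1 1 * z.2 (e l + e 2))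
        + (opY (ξ l)).1 z.1 * (z.2 (e 1 + e l) - 2 * z.1 0 * z.2 (e l + e 2))) := by
  have h := contDiff_projField ξ a b
  simp only [prolong2_kohnEq, eta2_eq h, xi_eq, base_projField, fib_projField, dX_aff, dU_aff,
    lift_aff, map_zero, Sm.zero_apply, lap_apply, opX_apply, opY_apply, Fin.sum_univ_three,
    kohnEq, pdS_comm 2 0, pdS_comm 2 1, add_comm (e 1) (e 0), add_comm (e 2) (e 0),
    add_comm (e 2) (e 1)]
  ring

theorem prolong1_projField (ξ : Fin 3 → Sm) (a b : Sm) (z : Jet) :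
    prolong1 (projField ξ a b) kohnLagrangian z
        + kohnLagrangian z * ∑ i, totalD i (xi (projField ξ a b) i) z =
      (ξ 0).1 z.1 * (4 * z.1 0 * z.2 (e 2) ^ 2 - 2 * z.2 (e 1) * z.2 (e 2))
      + (ξ 1).1 z.1 * (4 * z.1 1 * z.2 (e 2) ^ 2 + 2 * z.2 (e 0) * z.2 (e 2))
      + (z.2 (e 0) + 2 * z.1 1 * z.2 (e 2)) * ((opX a).1 z.1 * z.2 0 + (opX b).1 z.1
        + a.1 z.1 * (z.2 (e 0) + 2 * z.1 1 * z.2 (e 2)) - ∑ l, (opX (ξ l)).1 z.1 * z.2 (e l))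
      + (z.2 (e 1) - 2 * z.1 0 * z.2 (e 2)) * ((opY a).1 z.1 * z.2 0 + (opY b).1 z.1
        + a.1 z.1 * (z.2 (e 1) - 2 * z.1 0 * z.2 (e 2)) - ∑ l, (opY (ξ l)).1 z.1 * z.2 (e l))
      + kohnLagrangian z * ∑ i, (pdS i (ξ i)).1 z.1 := by
  have h := contDiff_projField ξ a b
  simp only [prolong1_kohnLagrangian, eta1_eq h, xi_eq, base_projField, fib_projField, dX_aff,
    dU_aff, totalD_lift (contDiff_aff _ _),
    lift_aff, map_zero, Sm.zero_apply, opX_apply, opY_apply, Fin.sum_univ_three,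
    kohnLagrangian]
  ring

/-! ### Lie point symmetries are affine in `u` -/

/-- A jet with prescribed coordinates of order at most two. -/
theorem exists_jet (p : Pt) (u v₀ v₁ v₂ q₀₀ q₀₁ q₀₂ q₁₁ q₁₂ q₂₂ : ℝ) : ∃ z : Jet, z.1 = p ∧
    z.2 0 = u ∧ z.2 (e 0) = v₀ ∧ z.2 (e 1) = v₁ ∧ z.2 (e 2) = v₂ ∧ z.2 (e 0 + e 0) = q₀₀ ∧
    z.2 (e 0 + e 1) = q₀₁ ∧ z.2 (e 0 + e 2) = q₀₂ ∧ z.2 (e 1 + e 1) = q₁₁ ∧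
    z.2 (e 1 + e 2) = q₁₂ ∧ z.2 (e 2 + e 2) = q₂₂ := by
  let f : ℕ → ℕ → ℕ → ℝ := fun i j k => match i, j, k with
    | 0, 0, 0 => u
    | 1, 0, 0 => v₀
    | 0, 1, 0 => v₁
    | 0, 0, 1 => v₂
    | 2, 0, 0 => q₀₀
    | 1, 1, 0 => q₀₁
    | 1, 0, 1 => q₀₂
    | 0, 2, 0 => q₁₁
    | 0, 1, 1 => q₁₂
    | 0, 0, 2 => q₂₂
    | _, _, _ => 0
  exact ⟨(p, fun α => f (α 0) (α 1) (α 2)), by simp [f]⟩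

theorem eq_of_dU_eq_zero {f : Pt × ℝ → ℝ} (hf : ContDiff ℝ ∞ f) (h : ∀ q, dU f q = 0) (p : Pt)
    (u : ℝ) : f (p, u) = f (p, 0) := by
  have hd : ∀ r : ℝ, HasDerivAt (fun r => f (p, r)) (dU f (p, r)) r := fun r =>
    ((hf.differentiable (by simp)) (p, r)).hasFDerivAt.comp_hasDerivAt r
      ((hasDerivAt_const r p).prodMk (hasDerivAt_id r))
  exact is_const_of_deriv_eq_zero (fun r => (hd r).differentiableAt)
    (fun r => by rw [(hd r).deriv, h]) u 0

/-- The restriction of a smooth function of `x, y, t, u` to `u = 0`. -/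
def atZero (f : Pt × ℝ → ℝ) (hf : ContDiff ℝ ∞ f) : Sm :=
  ⟨fun p => f (p, 0), show ContDiff ℝ ∞ fun p : Pt => f (p, 0) from
    hf.comp (contDiff_id.prodMk contDiff_const)⟩

theorem eq_aff_of_dU {f : Pt × ℝ → ℝ} (hf : ContDiff ℝ ∞ f) (h : ∀ q, dU f q = 0) :
    f = aff 0 (atZero f hf) := by
  funext ⟨p, u⟩
  simpa [aff, atZero] using eq_of_dU_eq_zero hf h p u

theorem eq_aff_of_dU_dU {f : Pt × ℝ → ℝ} (hf : ContDiff ℝ ∞ f) (h : ∀ q, dU (dU f) q = 0) :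
    f = aff (atZero (dU f) (contDiff_dU hf)) (atZero f hf) := by
  set a := atZero (dU f) (contDiff_dU hf)
  have ha : dU f = aff 0 a := eq_aff_of_dU (contDiff_dU hf) h
  have hg : ContDiff ℝ ∞ fun q => f q - aff a 0 q := hf.sub (contDiff_aff a 0)
  have hd : ∀ q, dU (fun q => f q - aff a 0 q) q = 0 := by
    intro q
    have h1 := congrFun ha q
    have h2 := congrFun (dU_aff a 0) q
    simp only [dU] at h1 h2 ⊢
    rw [fderiv_fun_sub ((hf.differentiable (by simp)) q)
      (((contDiff_aff a 0).differentiable (by simp)) q), sub_apply, h1, h2,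
      sub_self]
  funext ⟨p, u⟩
  have := eq_of_dU_eq_zero hg hd p u
  simp [aff, atZero] at this ⊢
  linarith

/-- Products of a first-order and a second-order coordinate arise only from `∂ξ/∂u`; their vanishing
makes `ξ` independent of `u`. After that, the only term quadratic in the first-order coordinates is
`∂²η/∂u²`. -/
theorem IsLiePointSymmetry.exists_projField {S : VField} (hS : IsLiePointSymmetry kohnEq S) :
    ∃ (ξ : Fin 3 → Sm) (a b : Sm), S = projField ξ a b := by
  obtain ⟨hc, H⟩ := hS
  -- The value of `u_xx` is chosen to solve the equation.
  have K : ∀ (q : Pt × ℝ) (v₀ v₁ q₀₁ q₀₂ : ℝ), ∃ z : Jet, (z.1 = q.1 ∧ z.2 0 = q.2 ∧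
      z.2 (e 0) = v₀ ∧ z.2 (e 1) = v₁ ∧ z.2 (e 2) = 0 ∧ z.2 (e 0 + e 0) = - 4 * q.1 1 * q₀₂ ∧
      z.2 (e 0 + e 1) = q₀₁ ∧ z.2 (e 0 + e 2) = q₀₂ ∧ z.2 (e 1 + e 1) = 0 ∧
      z.2 (e 1 + e 2) = 0 ∧ z.2 (e 2 + e 2) = 0) ∧ prolong2 S kohnEq z = 0 := by
    intro q v₀ v₁ q₀₁ q₀₂
    obtain ⟨z, hz⟩ := exists_jet q.1 q.2 v₀ v₁ 0 (- 4 * q.1 1 * q₀₂) q₀₁ q₀₂ 0 0 0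
    refine ⟨z, hz, H z ?_⟩
    obtain ⟨h1, h2, h3, h4, h5, h6, h7, h8, h9, h10, h11⟩ := hz
    simp only [kohnEq, h1, h6, h8, h9, h10, h11]
    ring
  have bil : ∀ (q : Pt × ℝ) (v₀ v₁ q₀₁ q₀₂ : ℝ),
      v₀ * (dU (base S 0) q * (-4 * q.1 1 * q₀₂ + 2 * q.1 1 * q₀₂) + dU (base S 1) q * q₀₁
        + dU (base S 2) q * q₀₂) + v₁ * (dU (base S 0) q * (q₀₁ - 2 * q.1 0 * q₀₂)) = 0 := by
    intro q v₀ v₁ q₀₁ q₀₂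
    obtain ⟨z, ⟨h1, h2, h3, h4, h5, h6, h7, h8, h9, h10, h11⟩, hz⟩ := K q v₀ v₁ q₀₁ q₀₂
    obtain ⟨y, ⟨i1, i2, i3, i4, i5, i6, i7, i8, i9, i10, i11⟩, hy⟩ := K q v₀ v₁ 0 0
    obtain ⟨w, ⟨j1, j2, j3, j4, j5, j6, j7, j8, j9, j10, j11⟩, hw⟩ := K q 0 0 q₀₁ q₀₂
    obtain ⟨o, ⟨k1, k2, k3, k4, k5, k6, k7, k8, k9, k10, k11⟩, ho⟩ := K q 0 0 0 0
    simp only [prolong2_kohnEq, eta2_eq hc, xi_eq, lift, Fin.sum_univ_three,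
      add_comm (e 1) (e 0), add_comm (e 2) (e 0), add_comm (e 2) (e 1),
      h1, h2, h3, h4, h5, h6, h7, h8, h9, h10, h11] at hz
    simp only [prolong2_kohnEq, eta2_eq hc, xi_eq, lift, Fin.sum_univ_three,
      add_comm (e 1) (e 0), add_comm (e 2) (e 0), add_comm (e 2) (e 1),
      i1, i2, i3, i4, i5, i6, i7, i8, i9, i10, i11] at hy
    simp only [prolong2_kohnEq, eta2_eq hc, xi_eq, lift, Fin.sum_univ_three,
      add_comm (e 1) (e 0), add_comm (e 2) (e 0), add_comm (e 2) (e 1),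
      j1, j2, j3, j4, j5, j6, j7, j8, j9, j10, j11] at hw
    simp only [prolong2_kohnEq, eta2_eq hc, xi_eq, lift, Fin.sum_univ_three,
      add_comm (e 1) (e 0), add_comm (e 2) (e 0), add_comm (e 2) (e 1),
      k1, k2, k3, k4, k5, k6, k7, k8, k9, k10, k11] at ho
    -- The mixed second difference keeps only the terms bilinear in first-order and second-order
    -- coordinates, which carry the factor `-2`.
    linear_combination (-1 / 2) * (hz - hy - hw + ho)
  have d0 : ∀ q, dU (base S 0) q = 0 := fun q => by linear_combination bil q 0 1 1 0
  have d1 : ∀ q, dU (base S 1) q = 0 := fun q => by linear_combination bil q 1 0 1 0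
  have d2 : ∀ q, dU (base S 2) q = 0 := fun q => by
    linear_combination bil q 1 0 0 1 + 2 * q.1 1 * d0 q
  have d : ∀ i q, dU (base S i) q = 0 := by
    intro i; fin_cases i
    exacts [d0, d1, d2]
  have hb : ∀ i, base S i = aff 0 (atZero (base S i) (contDiff_base hc i)) := fun i =>
    eq_aff_of_dU _ (d i)
  generalize hξ : (fun i => atZero (base S i) (contDiff_base hc i)) = ξ at *
  have hb' : ∀ i, base S i = aff 0 (ξ i) := by
    intro i; rw [← hξ]; exact hb i
  have quad : ∀ q, dU (dU (fib S)) q = 0 := by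
    intro q
    obtain ⟨z, ⟨h1, h2, h3, h4, h5, h6, h7, h8, h9, h10, h11⟩, hz⟩ := K q 1 0 0 0
    obtain ⟨y, ⟨i1, i2, i3, i4, i5, i6, i7, i8, i9, i10, i11⟩, hy⟩ := K q (-1) 0 0 0
    obtain ⟨o, ⟨k1, k2, k3, k4, k5, k6, k7, k8, k9, k10, k11⟩, ho⟩ := K q 0 0 0 0
    simp only [prolong2_kohnEq, eta2_eq hc, xi_eq, hb', dX_aff, dU_aff, map_zero,
      aff_zero, Fin.sum_univ_three, lift,
      add_comm (e 1) (e 0), add_comm (e 2) (e 0), add_comm (e 2) (e 1),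
      h1, h2, h3, h4, h5, h6, h7, h8, h9, h10, h11] at hz
    simp only [prolong2_kohnEq, eta2_eq hc, xi_eq, hb', dX_aff, dU_aff, map_zero,
      aff_zero, Fin.sum_univ_three, lift,
      add_comm (e 1) (e 0), add_comm (e 2) (e 0), add_comm (e 2) (e 1),
      i1, i2, i3, i4, i5, i6, i7, i8, i9, i10, i11] at hy
    simp only [prolong2_kohnEq, eta2_eq hc, xi_eq, hb', dX_aff, dU_aff, map_zero,
      aff_zero, Fin.sum_univ_three, lift,
      add_comm (e 1) (e 0), add_comm (e 2) (e 0), add_comm (e 2) (e 1),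
      k1, k2, k3, k4, k5, k6, k7, k8, k9, k10, k11] at ho
    -- The second difference at `u_x = 1, -1, 0` isolates the coefficient of `u_x²`.
    linear_combination (1 / 2) * (hz + hy - 2 * ho)
  refine ⟨ξ, atZero (dU (fib S)) (contDiff_dU (contDiff_fib hc)), atZero (fib S) (contDiff_fib hc),
    ?_⟩
  funext q
  refine Prod.ext (funext fun i => ?_) (congrFun (eq_aff_of_dU_dU (contDiff_fib hc) quad) q)
  have h := congrFun (hb' i) q
  simpa [aff, base, projField] using h

/-! ### The Lie point symmetries -/

section Apply

variable (f g : Sm) (c : ℝ) (p : Pt)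

theorem Sm.add_apply : (f + g).1 p = f.1 p + g.1 p := rfl
theorem Sm.sub_apply : (f - g).1 p = f.1 p - g.1 p := rfl
theorem Sm.neg_apply : (-f).1 p = -f.1 p := rfl
theorem Sm.mul_apply : (f * g).1 p = f.1 p * g.1 p := rfl
theorem Sm.smul_apply : (c • f).1 p = c * f.1 p := rfl
theorem Sm.algebraMap_apply : (algebraMap ℝ Sm c).1 p = c := rfl
theorem Sm.one_apply : (1 : Sm).1 p = 1 := rfl
theorem Sm.ofNat_apply (n : ℕ) [n.AtLeastTwo] : (ofNat(n) : Sm).1 p = ofNat(n) := rfl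

end Apply

theorem derivation_smul (D : Derivation ℝ Sm Sm) (c : ℝ) (f : Sm) : D (c • f) = c • D f :=
  D.map_smul c f

/-- The contact field on `ℝ³` with generating function `h`. -/
def contactXi (h : Sm) : Fin 3 → Sm :=
  ![(-(1 / 4) : ℝ) • opY h, (1 / 4 : ℝ) • opX h,
    h - (1 / 2 : ℝ) • (coord 1 * opY h) - (1 / 2 : ℝ) • (coord 0 * opX h)]

/-- The factor by which the symmetry with generating function `h` scales `u`. -/
def contactA (h : Sm) (c : ℝ) : Sm := (-(1 / 2) : ℝ) • opT h + algebraMap ℝ Sm c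

/-- The contact field with generating function `h`, extended to `ℝ³ × ℝ` by
`((c - Th/2) u + b) ∂/∂u`. -/
def contactField (h b : Sm) (c : ℝ) : VField := projField (contactXi h) (contactA h c) b

theorem contactXi_zero (h : Sm) : contactXi h 0 = (-(1 / 4) : ℝ) • opY h := rfl
theorem contactXi_one (h : Sm) : contactXi h 1 = (1 / 4 : ℝ) • opX h := rfl
theorem contactXi_two (h : Sm) : contactXi h 2
    = h - (1 / 2 : ℝ) • (coord 1 * opY h) - (1 / 2 : ℝ) • (coord 0 * opX h) := rfl

theorem Sm.ext_apply_iff {f g : Sm} : f = g ↔ ∀ p, f.1 p = g.1 p :=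
  ⟨fun h _ => h ▸ rfl, fun h => Subtype.ext (funext h)⟩

/-- Second-order coefficients give Cauchy–Riemann equations for `ξ 0, ξ 1` along `X, Y` and the
contact condition on `ξ 2`; first-order coefficients determine `Xa` and `Ya`, hence `a` up to a
constant. -/
theorem IsLiePointSymmetry.exists_contactField {S : VField} (hS : IsLiePointSymmetry kohnEq S) :
    ∃ (h b : Sm) (c : ℝ), IsContactPotential h ∧ lap b = 0 ∧ S = contactField h b c := by
  obtain ⟨ξ, a, b, rfl⟩ := hS.exists_projField
  have K : ∀ (p : Pt) (v₀ v₁ q₀₁ q₀₂ q₁₁ q₁₂ : ℝ),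
      (ξ 0).1 p * (-4 * q₁₂) + (ξ 1).1 p * (4 * q₀₂) + (lap b).1 p
      + 2 * ((opX a).1 p * v₀ + (opY a).1 p * v₁)
      - ((lap (ξ 0)).1 p * v₀ + (lap (ξ 1)).1 p * v₁)
      - 2 * (((opX (ξ 0)).1 p * (-q₁₁ - 2 * p 1 * q₀₂ + 4 * p 0 * q₁₂)
          + (opY (ξ 0)).1 p * (q₀₁ - 2 * p 0 * q₀₂))
        + ((opX (ξ 1)).1 p * (q₀₁ + 2 * p 1 * q₁₂) + (opY (ξ 1)).1 p * (q₁₁ - 2 * p 0 * q₁₂))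
        + ((opX (ξ 2)).1 p * q₀₂ + (opY (ξ 2)).1 p * q₁₂)) = 0 := by
    intro p v₀ v₁ q₀₁ q₀₂ q₁₁ q₁₂
    -- Jets with `u = u_t = u_tt = 0` and `u_xx` eliminated by the equation already suffice.
    obtain ⟨z, h1, h2, h3, h4, h5, h6, h7, h8, h9, h10, h11⟩ := exists_jet p 0 v₀ v₁ 0
      (-q₁₁ - 4 * p 1 * q₀₂ + 4 * p 0 * q₁₂) q₀₁ q₀₂ q₁₁ q₁₂ 0
    have hF : kohnEq z = 0 := by
      simp only [kohnEq, h1, h6, h8, h9, h10, h11]; ring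
    have hz := hS.2 z hF
    simp only [prolong2_projField, hF, Fin.sum_univ_three, add_comm (e 1) (e 0),
      h1, h2, h3, h4, h5, h6, h7, h8, h9, h10, h11] at hz
    linear_combination hz
  have hb : lap b = 0 := Sm.ext_apply_iff.mpr fun p => by
    simp only [Sm.zero_apply]; linear_combination K p 0 0 0 0 0 0
  have e1 : opY (ξ 0) = -opX (ξ 1) := Sm.ext_apply_iff.mpr fun p => by
    simp only [Sm.neg_apply]
    linear_combination (-1 / 2) * (K p 0 0 1 0 0 0 - K p 0 0 0 0 0 0)
  have e2 : opY (ξ 1) = opX (ξ 0) := Sm.ext_apply_iff.mpr fun p => by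
    linear_combination (-1 / 2) * (K p 0 0 0 0 1 0 - K p 0 0 0 0 0 0)
  have e3 : opX (ξ 2) = 2 * ξ 1 + 2 * coord 1 * opX (ξ 0) + 2 * coord 0 * opY (ξ 0) :=
    Sm.ext_apply_iff.mpr fun p => by
      simp only [Sm.add_apply, Sm.mul_apply, Sm.ofNat_apply, coord_apply]
      linear_combination (-1 / 2) * (K p 0 0 0 1 0 0 - K p 0 0 0 0 0 0)
  have e4 : opY (ξ 2) = -(2 * ξ 0) - 2 * coord 1 * opX (ξ 1) + 2 * coord 0 * opY (ξ 1)
      - 4 * coord 0 * opX (ξ 0) := Sm.ext_apply_iff.mpr fun p => by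
    simp only [Sm.add_apply, Sm.mul_apply, Sm.ofNat_apply, coord_apply, Sm.sub_apply, Sm.neg_apply]
    linear_combination (-1 / 2) * (K p 0 0 0 0 0 1 - K p 0 0 0 0 0 0)
  have e5 : lap (ξ 0) = 2 * opX a := Sm.ext_apply_iff.mpr fun p => by
    simp only [Sm.mul_apply, Sm.ofNat_apply]
    linear_combination - (K p 1 0 0 0 0 0 - K p 0 0 0 0 0 0)
  have e6 : lap (ξ 1) = 2 * opY a := Sm.ext_apply_iff.mpr fun p => by
    simp only [Sm.mul_apply, Sm.ofNat_apply]
    linear_combination - (K p 0 1 0 0 0 0 - K p 0 0 0 0 0 0)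
  -- The contraction of the field with the contact form `dt - 2y dx + 2x dy`, which annihilates `X`
  -- and `Y`.
  obtain ⟨h, hh⟩ : ∃ h, h = ξ 2 - 2 * coord 1 * ξ 0 + 2 * coord 0 * ξ 1 := ⟨_, rfl⟩
  have hX : opX h = 4 * ξ 1 := by
    simp only [hh, map_add, map_sub, derivation_mul, derivation_ofNat, opX_x, opX_y, e3, e1]
    ring
  have hY : opY h = -(4 * ξ 0) := by
    simp only [hh, map_add, map_sub, derivation_mul, derivation_ofNat, opY_x, opY_y, e4, e1, e2]
    ring
  have H : IsContactPotential h := by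
    constructor
    · simp only [hX, hY, map_neg, derivation_mul, derivation_ofNat, e1]; ring
    · simp only [hX, hY, map_neg, derivation_mul, derivation_ofNat, e2]; ring
  have l0 : 4 * lap (ξ 0) = -(4 * opT (opX h)) := by
    have h1 : 4 * lap (ξ 0) = -(opX (opX (opY h)) + opY (opY (opY h))) := by
      simp only [hY, lap, map_neg, derivation_mul, derivation_ofNat, mul_zero, add_zero]
      ring
    rw [h1, H.XY, H.YY, H.YXX, map_neg, derivation_mul, derivation_ofNat, opX_opT]
    ring
  have l1 : 4 * lap (ξ 1) = -(4 * opT (opY h)) := by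
    have h1 : 4 * lap (ξ 1) = opX (opX (opX h)) + opY (opY (opX h)) := by
      simp only [hX, lap, derivation_mul, derivation_ofNat, mul_zero, add_zero]
      ring
    rw [h1, H.YX, H.XXX, derivation_mul, derivation_ofNat, opY_opT]
    ring
  -- The third-order relations turn `2Xa = Δξ⁰`, `2Ya = Δξ¹` into `2Xa = -XTh`, `2Ya = -YTh`, so `2a
  -- + Th` is constant.
  have kX : opX (2 * a + opT h) = 0 := by
    apply Sm.eq_of_natCast_mul_eq 4 (by norm_num)
    simp only [map_add, derivation_mul, derivation_ofNat, opX_opT]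
    push_cast
    linear_combination l0 - 4 * e5
  have kY : opY (2 * a + opT h) = 0 := by
    apply Sm.eq_of_natCast_mul_eq 4 (by norm_num)
    simp only [map_add, derivation_mul, derivation_ofNat, opY_opT]
    push_cast
    linear_combination l1 - 4 * e6
  have hc := (2 * a + opT h).eq_apply_zero_of_opX_opY kX kY
  generalize (2 * a + opT h).1 0 = k at hc
  refine ⟨h, b, k / 2, H, hb, ?_⟩
  have x0 : ξ 0 = contactXi h 0 := Sm.ext_apply_iff.mpr fun p => by
    rw [contactXi_zero, hY]
    simp only [Sm.smul_apply, Sm.neg_apply, Sm.mul_apply, Sm.ofNat_apply]; ring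
  have x1 : ξ 1 = contactXi h 1 := Sm.ext_apply_iff.mpr fun p => by
    rw [contactXi_one, hX]
    simp only [Sm.smul_apply, Sm.mul_apply, Sm.ofNat_apply]; ring
  have x2 : ξ 2 = contactXi h 2 := Sm.ext_apply_iff.mpr fun p => by
    rw [contactXi_two, hX, hY, hh]
    simp only [Sm.smul_apply, Sm.neg_apply, Sm.mul_apply, Sm.ofNat_apply, Sm.add_apply,
      Sm.sub_apply]
    ring
  have ha : a = contactA h (k / 2) := Sm.ext_apply_iff.mpr fun p => by
    have := hc p
    simp only [contactA, Sm.smul_apply, Sm.mul_apply, Sm.ofNat_apply, Sm.add_apply,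
      Sm.algebraMap_apply] at this ⊢
    linear_combination this / 2
  have hξ : ξ = contactXi h := by
    funext i; fin_cases i
    exacts [x0, x1, x2]
  rw [contactField, ← hξ, ← ha]

/-- The zeroth-order term drops out because `ΔTh = 2 TX²h = 0`, and the first-order terms cancel by
the formulas for `X³h` and `YX²h`; only a multiple of the equation is left. -/
theorem prolong2_contactField {h b : Sm} (H : IsContactPotential h) (hb : lap b = 0) (c : ℝ)
    (z : Jet) : prolong2 (contactField h b c) kohnEq z
      = ((contactA h c).1 z.1 - (opT h).1 z.1) * kohnEq z := by
  simp only [contactField, prolong2_projField, Fin.sum_univ_three, contactXi_zero, contactXi_one,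
    contactXi_two, contactA, hb]
  simp only [lap, map_add, map_sub, derivation_smul, map_neg, Derivation.map_algebraMap, derivation_mul,
    derivation_ofNat, opX_opT, opY_opT, opX_x, opX_y, opY_x, opY_y,
    H.XY, H.YX, H.YY, H.XXX, H.YXX, H.TXX, map_zero, Derivation.map_one_eq_zero]
  simp only [Sm.smul_apply, Sm.mul_apply, Sm.ofNat_apply, Sm.add_apply, Sm.one_apply,
      Sm.sub_apply, Sm.neg_apply, Sm.zero_apply, Sm.algebraMap_apply, coord_apply, kohnEq,
      add_comm (e 1) (e 0)]
  ring

theorem isLiePointSymmetry_contactField {h b : Sm} (H : IsContactPotential h) (hb : lap b = 0)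
    (c : ℝ) : IsLiePointSymmetry kohnEq (contactField h b c) :=
  ⟨contDiff_projField _ _ _, fun z hz => by rw [prolong2_contactField H hb, hz, mul_zero]⟩

/-! ### The Noether condition up to a divergence -/

/-- The gradient of `f` with respect to the symbol of the Kohn Laplacian. -/
def grad (f : Sm) : Fin 3 → Sm :=
  ![opX f, opY f, 2 * coord 1 * opX f - 2 * coord 0 * opY f]

/-- The current of the variational symmetry with zeroth order part `(a u + b) ∂/∂u`. -/
def current (a b : Sm) (i : Fin 3) (z : Jet) : ℝ :=
  z.2 0 * lift (aff ((1 / 2 : ℝ) • grad a i) (grad b i)) z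

theorem isDifferentialFunction_current (a b : Sm) (i : Fin 3) :
    IsDifferentialFunction (current a b i) :=
  (isDifferentialFunction_coord 0).mul (isDifferentialFunction_lift (contDiff_aff _ _))

theorem div_grad (f : Sm) (p : Pt) : (pdS 0 (grad f 0)).1 p + (pdS 1 (grad f 1)).1 p
    + (pdS 2 (grad f 2)).1 p = (lap f).1 p := by
  have : pdS 0 (grad f 0) + pdS 1 (grad f 1) + pdS 2 (grad f 2) = lap f := by
    simp only [pdS_zero_eq, pdS_one_eq, pdS_two_eq, grad, lap, Matrix.cons_val, map_sub,
      derivation_mul, derivation_ofNat, opT_x, opT_y]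
    ring
  rw [← this]; rfl

theorem sum_totalD_current (a b : Sm) (z : Jet) : ∑ i, totalD i (current a b i) z
    = (z.2 (e 0) + 2 * z.1 1 * z.2 (e 2)) * ((opX a).1 z.1 * z.2 0 + (opX b).1 z.1)
      + (z.2 (e 1) - 2 * z.1 0 * z.2 (e 2)) * ((opY a).1 z.1 * z.2 0 + (opY b).1 z.1)
      + (lap a).1 z.1 * z.2 0 ^ 2 / 2 + (lap b).1 z.1 * z.2 0 := by
  have h : ∀ i, totalD i (current a b i) z = z.2 (e i) * ((grad a i).1 z.1 * z.2 0
      + (grad b i).1 z.1) + (pdS i (grad a i)).1 z.1 * z.2 0 ^ 2 / 2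
      + (pdS i (grad b i)).1 z.1 * z.2 0 := by
    intro i
    unfold current
    rw [totalD_mul (isDifferentialFunction_coord 0) (isDifferentialFunction_lift (contDiff_aff _ _)),
      totalD_coord, zero_add, totalD_lift (contDiff_aff _ _), dX_aff, dU_aff]
    simp only [lift_aff, derivation_smul, Sm.smul_apply, Sm.zero_apply]
    ring
  rw [← div_grad a, ← div_grad b, Fin.sum_univ_three, h, h, h]
  simp only [grad, Matrix.cons_val, Sm.sub_apply, Sm.mul_apply, Sm.ofNat_apply, coord_apply]
  ring

/-- The field dilates horizontal directions at rate `Th/2`, so the Lagrangian changes by `-Th`,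
while `div ξ = 2Th` and the weight of `u` contributes `2c - Th`: these add up to `2c`. The terms
with derivatives of the weight and of `b` form a divergence since both are Kohn-harmonic. -/
theorem prolong1_contactField {h b : Sm} (H : IsContactPotential h) (hb : lap b = 0) (c : ℝ)
    (z : Jet) : prolong1 (contactField h b c) kohnLagrangian z
        + kohnLagrangian z * ∑ i, totalD i (xi (contactField h b c) i) z
      = 2 * c * kohnLagrangian z + ∑ i, totalD i (current (contactA h c) b i) z := by
  rw [sum_totalD_current, hb, contactField, prolong1_projField]
  simp only [Fin.sum_univ_three, contactXi_zero, contactXi_one,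
    contactXi_two, contactA, pdS_zero_eq, pdS_one_eq, pdS_two_eq]
  simp only [lap, map_add, map_sub, derivation_smul, Derivation.map_algebraMap, derivation_mul,
    opX_opT, opY_opT, opX_x, opX_y, opY_x, opY_y, opT_x, opT_y,
    H.XY, H.YX, H.YY, H.TXX, map_zero]
  simp only [Sm.smul_apply, Sm.mul_apply, Sm.ofNat_apply, Sm.add_apply, Sm.one_apply,
      Sm.sub_apply, Sm.neg_apply, Sm.zero_apply, Sm.algebraMap_apply, coord_apply,
      kohnLagrangian]
  ring

theorem isNoetherSymmetry_contactField {h b : Sm} (H : IsContactPotential h) (hb : lap b = 0) :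
    IsNoetherSymmetry kohnEq kohnLagrangian (contactField h b 0) :=
  ⟨isLiePointSymmetry_contactField H hb 0, current (contactA h 0) b,
    isDifferentialFunction_current _ _, fun z => by
      rw [prolong1_contactField H hb, mul_zero, zero_mul, zero_add]⟩

/-! ### The Lagrangian is not a divergence -/

/-- The jet at `p` of the function with derivatives `J`. -/
def jetOf (J : MIdx → Sm) (p : Pt) : Jet := (p, fun α => (J α).1 p)

theorem IsDifferentialFunction.contDiff_comp_jetOf {P : Jet → ℝ} (hP : IsDifferentialFunction P)
    (J : MIdx → Sm) : ContDiff ℝ ∞ fun p => P (jetOf J p) := by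
  obtain ⟨s, g, hg, hPg⟩ := hP
  simp only [hPg]
  exact hg.comp (contDiff_id.prodMk (contDiff_pi.mpr fun α => (J α).contDiff))

/-- The chain rule: on the jet of an actual function, a total derivative is an ordinary partial
derivative, whatever the order of `P`. -/
theorem IsDifferentialFunction.totalD_jetOf {P : Jet → ℝ} (hP : IsDifferentialFunction P)
    {J : MIdx → Sm} (hJ : ∀ i α, pdS i (J α) = J (α + e i)) (i : Fin 3) (p : Pt) :
    totalD i P (jetOf J p) = pd i (fun p => P (jetOf J p)) p := by
  obtain ⟨s, g, hg, hPg⟩ := hP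
  have hd : HasFDerivAt (fun p => restr s (jetOf J p))
      ((ContinuousLinearMap.id ℝ Pt).prod
        (ContinuousLinearMap.pi fun α : s => fderiv ℝ (J α).1 p)) p :=
    (hasFDerivAt_id p).prodMk
      (hasFDerivAt_pi.mpr fun α => ((J α).differentiable p).hasFDerivAt)
  have hc := ((hg.differentiable (by simp)) (restr s (jetOf J p))).hasFDerivAt.comp p hd
  have hcomp : (fun p => P (jetOf J p)) = g ∘ fun p => restr s (jetOf J p) := funext fun p => hPg _
  rw [totalD_of_factor hg hPg, pd, hcomp, hc.fderiv, ContinuousLinearMap.comp_apply]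
  congr 1
  refine Prod.ext rfl (funext fun α => ?_)
  change (J (α + e i)).1 p = _
  rw [← hJ]
  rfl

open MeasureTheory in
theorem integral_pd_eq_zero {ψ : Pt → ℝ} (hψ : ContDiff ℝ ∞ ψ) (hc : HasCompactSupport ψ)
    (i : Fin 3) : Integrable (pd i ψ) ∧ ∫ p, pd i ψ p = 0 := by
  have h1 : Integrable ψ := hψ.continuous.integrable_of_hasCompactSupport hc
  have h2 : Integrable (pd i ψ) :=
    (contDiff_pd i hψ).continuous.integrable_of_hasCompactSupport (hc.fderiv_apply ℝ _)
  refine ⟨h2, ?_⟩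
  -- Integration by parts against the constant `1`.
  have h := integral_mul_fderiv_eq_neg_fderiv_mul_of_integrable (μ := volume) (𝕜 := ℝ)
    (f := fun _ : Pt => (1 : ℝ)) (g := ψ) (v := Pi.single i 1) (by simp)
    (by simp only [one_mul]; exact h2) (by simpa using h1) (by fun_prop)
    (fun x _ => hψ.differentiable (by simp) x)
  simpa [pd] using h

/-- A smooth bump function on the line. -/
def lineBump : ContDiffBump (0 : ℝ) := ⟨1, 2, one_pos, one_lt_two⟩

theorem lineBump_contDiff : ContDiff ℝ ∞ lineBump := lineBump.contDiff

theorem contDiff_iteratedDeriv_lineBump (n : ℕ) : ContDiff ℝ ∞ (iteratedDeriv n lineBump) := by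
  induction n with
  | zero => simpa using lineBump_contDiff
  | succ n ih =>
    rw [iteratedDeriv_succ]
    exact (contDiff_infty_iff_deriv.mp ih).2

/-- The `n`-th derivative of the bump function, in the `j`-th variable. -/
def bumpDeriv (n : ℕ) (j : Fin 3) : Sm :=
  ⟨fun p => iteratedDeriv n lineBump (p j),
    show ContDiff ℝ ∞ fun p : Pt => iteratedDeriv n lineBump (p j) from
      (contDiff_iteratedDeriv_lineBump n).comp (contDiff_apply ℝ ℝ j)⟩

theorem pdS_bumpDeriv (i : Fin 3) (n : ℕ) (j : Fin 3) :
    pdS i (bumpDeriv n j) = if i = j then bumpDeriv (n + 1) j else 0 := by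
  ext p
  have h : HasFDerivAt (bumpDeriv n j).1
      (deriv (iteratedDeriv n lineBump) (p j) •
        ContinuousLinearMap.proj (R := ℝ) (φ := fun _ : Fin 3 => ℝ) j) p :=
    HasDerivAt.comp_hasFDerivAt p
      ((contDiff_iteratedDeriv_lineBump n).differentiable (by simp) _).hasDerivAt
      (hasFDerivAt_apply j p)
  rw [pdS_apply, pd, h.fderiv]
  by_cases hij : i = j
  · subst hij
    simp [bumpDeriv, iteratedDeriv_succ]
  · simp [hij, Ne.symm hij]

/-- The derivatives of the function `ρ(x) ρ(y) ρ(t)`, with `ρ` the bump function. -/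
def bumpJet (α : MIdx) : Sm := bumpDeriv (α 0) 0 * bumpDeriv (α 1) 1 * bumpDeriv (α 2) 2

theorem pdS_bumpJet (i : Fin 3) (α : MIdx) : pdS i (bumpJet α) = bumpJet (α + e i) := by
  fin_cases i <;>
    simp [bumpJet, pdS_bumpDeriv] <;> ring

theorem bumpDeriv_eq_zero (n : ℕ) (j : Fin 3) {p : Pt} (hp : 2 < |p j|) :
    (bumpDeriv n j).1 p = 0 := by
  have h : (lineBump : ℝ → ℝ) =ᶠ[nhds (p j)] fun _ => 0 := by
    have : {s : ℝ | 2 < |s|} ∈ nhds (p j) := (isOpen_lt continuous_const continuous_abs).mem_nhds hp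
    filter_upwards [this] with s hs
    exact lineBump.zero_of_le_dist (by simpa [lineBump, Real.dist_eq] using (le_of_lt hs))
  change iteratedDeriv n lineBump (p j) = 0
  rw [h.iteratedDeriv_eq]
  simp

theorem bumpJet_eq_zero (α : MIdx) {p : Pt} (hp : p ∉ Metric.closedBall (0 : Pt) 2) :
    (bumpJet α).1 p = 0 := by
  have : ∃ j, 2 < |p j| := by
    by_contra! h
    exact hp (by
      rw [mem_closedBall_zero_iff]
      exact (pi_norm_le_iff_of_nonneg zero_le_two).mpr h)
  obtain ⟨j, hj⟩ := this
  change (bumpDeriv (α 0) 0).1 p * (bumpDeriv (α 1) 1).1 p * (bumpDeriv (α 2) 2).1 p = 0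
  fin_cases j
  · rw [bumpDeriv_eq_zero _ 0 hj]; ring
  · rw [bumpDeriv_eq_zero _ 1 hj]; ring
  · rw [bumpDeriv_eq_zero _ 2 hj]; ring

theorem kohnLagrangian_eq (z : Jet) : kohnLagrangian z =
    (z.2 (e 0) + 2 * z.1 1 * z.2 (e 2)) ^ 2 / 2 + (z.2 (e 1) - 2 * z.1 0 * z.2 (e 2)) ^ 2 / 2 := by
  rw [kohnLagrangian]; ring

theorem exists_kohnLagrangian_bumpJet_ne_zero : ∃ p, kohnLagrangian (jetOf bumpJet p) ≠ 0 := by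
  have hd : ∃ s, deriv lineBump s ≠ 0 := by
    by_contra! h
    have := is_const_of_deriv_eq_zero (lineBump_contDiff.differentiable (by simp)) h 0 2
    rw [lineBump.one_of_mem_closedBall (by simp [lineBump]),
      lineBump.zero_of_le_dist (by simp [lineBump])] at this
    exact one_ne_zero this
  obtain ⟨s, hs⟩ := hd
  -- On the `x`-axis the other two bump factors equal `1` and `y = 0`, so `Xu = ρ'(s)`.
  refine ⟨![s, 0, 0], ?_⟩
  have h0 : lineBump (0 : ℝ) = 1 := lineBump.one_of_mem_closedBall (by simp [lineBump])
  have hx : (jetOf bumpJet ![s, 0, 0]).2 (e 0) = deriv lineBump s := by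
    change (bumpDeriv _ 0).1 _ * (bumpDeriv _ 1).1 _ * (bumpDeriv _ 2).1 _ = _
    simp [bumpDeriv, h0]
  have hy : (jetOf bumpJet ![s, 0, 0]).1 1 = 0 := rfl
  rw [kohnLagrangian_eq, hx, hy, mul_zero, zero_mul, add_zero]
  positivity

open MeasureTheory in
/-- A nonzero multiple of the Lagrangian is not a total divergence. -/
theorem eq_zero_of_kohnLagrangian_divergence (c : ℝ) {φ : Fin 3 → Jet → ℝ}
    (hφ : ∀ i, IsDifferentialFunction (φ i))
    (h : ∀ z, c * kohnLagrangian z = ∑ i, totalD i (φ i) z) : c = 0 := by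
  -- `φ` need not vanish on the zero jet; subtracting its value there produces compact support.
  let ψ : Fin 3 → Pt → ℝ := fun i p => φ i (jetOf bumpJet p) - φ i (jetOf 0 p)
  have hψ : ∀ i, ContDiff ℝ ∞ (ψ i) := fun i =>
    ((hφ i).contDiff_comp_jetOf bumpJet).sub ((hφ i).contDiff_comp_jetOf 0)
  have hjet : ∀ p ∉ Metric.closedBall (0 : Pt) 2, jetOf bumpJet p = jetOf 0 p := fun p hp =>
    Prod.ext rfl (funext fun α => bumpJet_eq_zero α hp)
  have hcψ : ∀ i, HasCompactSupport (ψ i) := fun i =>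
    HasCompactSupport.intro (isCompact_closedBall (0 : Pt) 2) fun p hp => by
      simp only [ψ, hjet p hp, sub_self]
  have hdiv : ∀ p, c * kohnLagrangian (jetOf bumpJet p) = ∑ i, pd i (ψ i) p := by
    intro p
    have h0 : kohnLagrangian (jetOf 0 p) = 0 := by
      simp [kohnLagrangian, jetOf]
    have h1 := h (jetOf bumpJet p)
    have h2 := h (jetOf 0 p)
    rw [h0, mul_zero] at h2
    rw [← sub_zero (c * _), h1, h2, ← Finset.sum_sub_distrib]
    refine Finset.sum_congr rfl fun i _ => ?_
    rw [(hφ i).totalD_jetOf pdS_bumpJet, (hφ i).totalD_jetOf (J := 0) (fun _ _ => map_zero _), pd, pd, pd,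
      fderiv_fun_sub (((hφ i).contDiff_comp_jetOf bumpJet).differentiable (by simp) p)
        (((hφ i).contDiff_comp_jetOf 0).differentiable (by simp) p)]
    rfl
  have hint : ∫ p, c * kohnLagrangian (jetOf bumpJet p) = 0 := by
    simp only [hdiv]
    rw [integral_finsetSum _ fun i _ => (integral_pd_eq_zero (hψ i) (hcψ i) i).1]
    exact Finset.sum_eq_zero fun i _ => (integral_pd_eq_zero (hψ i) (hcψ i) i).2
  rw [integral_const_mul] at hint
  refine (mul_eq_zero.mp hint).resolve_right (ne_of_gt ?_)
  obtain ⟨p, hp⟩ := exists_kohnLagrangian_bumpJet_ne_zero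
  refine Continuous.integral_pos_of_hasCompactSupport_nonneg_nonzero (x := p) ?_ ?_ ?_ hp
  · have hJ : ∀ α, Continuous fun p => (bumpJet α).1 p := fun α => (bumpJet α).contDiff.continuous
    simp only [kohnLagrangian, jetOf]
    fun_prop
  · refine HasCompactSupport.intro (isCompact_closedBall (0 : Pt) 2) fun p hp => ?_
    rw [hjet p hp]
    simp [kohnLagrangian, jetOf]
  · intro p
    change 0 ≤ kohnLagrangian (jetOf bumpJet p)
    rw [kohnLagrangian_eq]
    positivity

theorem isNoetherSymmetry_contactField_iff {h b : Sm} (H : IsContactPotential h) (hb : lap b = 0)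
    (c : ℝ) : IsNoetherSymmetry kohnEq kohnLagrangian (contactField h b c) ↔ c = 0 := by
  constructor
  · rintro ⟨-, φ, hφ, hdiv⟩
    have h2 : 2 * c = 0 := by
      refine eq_zero_of_kohnLagrangian_divergence (2 * c)
        (φ := fun i z => φ i z - current (contactA h c) b i z)
        (fun i => (hφ i).sub (isDifferentialFunction_current _ _ i)) fun z => ?_
      have h1 := hdiv z
      rw [prolong1_contactField H hb] at h1
      simp only [totalD_sub (hφ _) (isDifferentialFunction_current _ _ _), Finset.sum_sub_distrib]
      linarith
    linarith
  · rintro rfl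
    exact isNoetherSymmetry_contactField H hb

/-! ### Brackets -/

/-- The derivative of `f` along the field with coefficients `ξ`. -/
def along (ξ : Fin 3 → Sm) (f : Sm) : Sm := ∑ j, ξ j * pdS j f

theorem fderiv_eq_sum (f : Sm) (p v : Pt) : fderiv ℝ f.1 p v = ∑ j, v j * (pdS j f).1 p := by
  have hv : v = ∑ i, v i • (Pi.single i (1 : ℝ) : Pt) := by
    ext j; simp [Finset.sum_apply, Pi.single_apply]
  conv_lhs => rw [hv]
  simp only [map_sum, map_smul]
  rfl

theorem fderiv_eq_along (ξ : Fin 3 → Sm) (f : Sm) (p : Pt) :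
    fderiv ℝ f.1 p (fun j => (ξ j).1 p) = (along ξ f).1 p := by
  rw [fderiv_eq_sum, along, Fin.sum_univ_three, Fin.sum_univ_three]
  rfl

theorem fderiv_projField (ξ : Fin 3 → Sm) (a b : Sm) (q v : Pt × ℝ) :
    fderiv ℝ (projField ξ a b) q v
      = (fun i => fderiv ℝ (ξ i).1 q.1 v.1, fderiv ℝ (aff a b) q v) := by
  have h : HasFDerivAt (projField ξ a b)
      ((ContinuousLinearMap.pi fun i =>
        (fderiv ℝ (ξ i).1 q.1).comp (ContinuousLinearMap.fst ℝ Pt ℝ)).prod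
        (fderiv ℝ (aff a b) q)) q :=
    (hasFDerivAt_pi.mpr fun i =>
      ((ξ i).differentiable q.1).hasFDerivAt.comp q hasFDerivAt_fst).prodMk
      (hasFDerivAt_aff a b q).differentiableAt.hasFDerivAt
  rw [h.fderiv]
  rfl

theorem lieBracket_projField (ξ ξ' : Fin 3 → Sm) (a a' b b' : Sm) :
    VectorField.lieBracket ℝ (projField ξ a b) (projField ξ' a' b')
      = projField (fun i => along ξ (ξ' i) - along ξ' (ξ i)) (along ξ a' - along ξ' a)
        ((along ξ b' - a * b') - (along ξ' b - a' * b)) := by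
  funext q
  rw [VectorField.lieBracket, fderiv_projField, fderiv_projField]
  refine Prod.ext (funext fun i => ?_) ?_
  · change fderiv ℝ (ξ' i).1 q.1 (fun j => (ξ j).1 q.1)
      - fderiv ℝ (ξ i).1 q.1 (fun j => (ξ' j).1 q.1) = _
    rw [fderiv_eq_along, fderiv_eq_along]
    rfl
  · change fderiv ℝ (aff a' b') q (fun j => (ξ j).1 q.1, aff a b q)
      - fderiv ℝ (aff a b) q (fun j => (ξ' j).1 q.1, aff a' b' q) = aff _ _ q
    simp only [fderiv_aff, fderiv_eq_along, aff, Sm.sub_apply, Sm.mul_apply]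
    ring

/-- In the left-invariant frame the contact field is `-(Yh/4) X + (Xh/4) Y + h T`. -/
theorem along_contactXi (h f : Sm) : along (contactXi h) f
    = (-(1 / 4) : ℝ) • (opY h * opX f) + (1 / 4 : ℝ) • (opX h * opY f) + h * opT f := by
  refine Sm.ext_apply_iff.mpr fun p => ?_
  simp only [along, Fin.sum_univ_three, contactXi_zero, contactXi_one, contactXi_two, pdS_zero_eq,
    pdS_one_eq, pdS_two_eq, Sm.smul_apply, Sm.mul_apply, Sm.ofNat_apply, Sm.add_apply,
    Sm.sub_apply, coord_apply]
  ring

/-- The contact bracket of generating functions. -/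
def contactBracket (h k : Sm) : Sm :=
  h * opT k - k * opT h + (1 / 4 : ℝ) • (opX h * opY k - opY h * opX k)

theorem IsContactPotential.contactBracket {h k : Sm} (H : IsContactPotential h)
    (K : IsContactPotential k) : IsContactPotential (contactBracket h k) := by
  constructor <;>
  · refine Sm.ext_apply_iff.mpr fun p => ?_
    simp only [Kohn.contactBracket, map_add, map_sub, derivation_smul, map_neg, derivation_mul,
      derivation_ofNat, opX_opT, opY_opT,
      H.XY, H.YX, H.YY, H.XXX, H.YXX, H.TXX,
      K.XY, K.YX, K.YY, K.XXX, K.YXX, K.TXX]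
    simp only [Sm.smul_apply, Sm.mul_apply, Sm.ofNat_apply, Sm.add_apply,
      Sm.sub_apply, Sm.neg_apply, Sm.zero_apply]
    ring

theorem contactXi_contactBracket {h k : Sm} (H : IsContactPotential h)
    (K : IsContactPotential k) (i : Fin 3) : contactXi (contactBracket h k) i
      = along (contactXi h) (contactXi k i) - along (contactXi k) (contactXi h i) := by
  fin_cases i <;>
  · refine Sm.ext_apply_iff.mpr fun p => ?_
    simp only [along_contactXi]
    simp only [Fin.zero_eta, Fin.mk_one, Fin.reduceFinMk, contactXi_zero, contactXi_one,
      contactXi_two, Kohn.contactBracket, map_add, map_sub, derivation_smul,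
      derivation_mul, opX_opT, opY_opT, opX_x, opX_y, opY_x, opY_y, opT_x, opT_y,
      H.XY, H.YX, H.YY, K.XY, K.YX, K.YY]
    simp only [Sm.smul_apply, Sm.mul_apply, Sm.ofNat_apply, Sm.add_apply, coord_apply,
      Sm.sub_apply, Sm.neg_apply, Sm.zero_apply, Sm.one_apply]
    ring

/-- Since `T` commutes with `X` and `Y`, applying it to the contact bracket gives `ξ_h(Tk) -
ξ_k(Th)`; no equation on `h` or `k` is needed. -/
theorem contactA_contactBracket (h k : Sm) : contactA (contactBracket h k) 0
      = along (contactXi h) (contactA k 0) - along (contactXi k) (contactA h 0) := by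
  refine Sm.ext_apply_iff.mpr fun p => ?_
  simp only [along_contactXi, contactA, Kohn.contactBracket, map_add, map_sub, derivation_smul,
    derivation_mul, opX_opT, opY_opT, map_zero]
  simp only [Sm.smul_apply, Sm.mul_apply, Sm.add_apply, Sm.sub_apply, Sm.zero_apply]
  ring

/-- Infinitesimal symmetries carry solutions to solutions; this is the action of a contact field on
the `W_β` by brackets. -/
theorem lap_along {h b : Sm} (H : IsContactPotential h) (hb : lap b = 0) :
    lap (along (contactXi h) b - contactA h 0 * b) = 0 := by
  have hb' : opY (opY b) = -opX (opX b) := by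
    rw [lap] at hb; linear_combination hb
  refine Sm.ext_apply_iff.mpr fun p => ?_
  simp only [lap, along_contactXi, contactA, map_add, map_sub, map_neg, derivation_smul,
    derivation_mul, derivation_ofNat, opX_opT, opY_opT, map_zero, add_zero, opY_opX b,
    opY_opX (opX b), opY_opX (opY b), hb',
    H.XY, H.YX, H.YY, H.XXX, H.YXX, H.TXX]
  simp only [Sm.smul_apply, Sm.mul_apply, Sm.ofNat_apply, Sm.add_apply,
    Sm.sub_apply, Sm.neg_apply, Sm.zero_apply]
  ring

theorem lap_sub (f g : Sm) : lap (f - g) = lap f - lap g := by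
  simp only [lap, map_sub]; ring

theorem lap_add (f g : Sm) : lap (f + g) = lap f + lap g := by
  simp only [lap, map_add]; ring

theorem lap_smul (c : ℝ) (f : Sm) : lap (c • f) = c • lap f := by
  simp only [lap, derivation_smul, smul_add]

theorem lap_zero : lap 0 = 0 := by simp [lap]

theorem lieBracket_contactField {h k : Sm} (H : IsContactPotential h) (K : IsContactPotential k)
    (b b' : Sm) : VectorField.lieBracket ℝ (contactField h b 0) (contactField k b' 0)
      = contactField (contactBracket h k) ((along (contactXi h) b' - contactA h 0 * b')
        - (along (contactXi k) b - contactA k 0 * b)) 0 := by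
  rw [contactField, contactField, lieBracket_projField, contactField, contactA_contactBracket,
    funext (contactXi_contactBracket H K)]

theorem IsContactPotential.add {h k : Sm} (H : IsContactPotential h) (K : IsContactPotential k) :
    IsContactPotential (h + k) :=
  ⟨by simp only [map_add, H.eqXX, K.eqXX],
    by simp only [map_add]; linear_combination H.eqXY + K.eqXY⟩

theorem IsContactPotential.smul (c : ℝ) {h : Sm} (H : IsContactPotential h) :
    IsContactPotential (c • h) :=
  ⟨by simp only [derivation_smul, H.eqXX],
    by simp only [derivation_smul, ← smul_add, H.eqXY, smul_zero]⟩

theorem isContactPotential_zero : IsContactPotential 0 := ⟨by simp, by simp⟩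

theorem contactField_add (h k b b' : Sm) : contactField (h + k) (b + b') 0
    = contactField h b 0 + contactField k b' 0 := by
  funext q
  refine Prod.ext (funext fun i => ?_) ?_
  · change (contactXi (h + k) i).1 q.1 = (contactXi h i).1 q.1 + (contactXi k i).1 q.1
    fin_cases i <;>
    · simp only [Fin.zero_eta, Fin.mk_one, Fin.reduceFinMk, contactXi_zero, contactXi_one,
        contactXi_two, map_add, Sm.smul_apply, Sm.mul_apply, Sm.add_apply, Sm.sub_apply]
      ring
  · change aff _ _ q = aff _ _ q + aff _ _ q
    simp only [aff, contactA, map_add, map_zero, Sm.smul_apply, Sm.add_apply, Sm.zero_apply]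
    ring

theorem contactField_smul (c : ℝ) (h b : Sm) : contactField (c • h) (c • b) 0
    = c • contactField h b 0 := by
  funext q
  refine Prod.ext (funext fun i => ?_) ?_
  · change (contactXi (c • h) i).1 q.1 = c * (contactXi h i).1 q.1
    fin_cases i <;>
    · simp only [Fin.zero_eta, Fin.mk_one, Fin.reduceFinMk, contactXi_zero, contactXi_one,
        contactXi_two, derivation_smul, Sm.smul_apply, Sm.mul_apply, Sm.sub_apply]
      ring
  · change aff _ _ q = c * aff _ _ q
    simp only [aff, contactA, derivation_smul, map_zero, Sm.smul_apply, Sm.add_apply,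
      Sm.zero_apply]
    ring

theorem contactField_zero : contactField 0 0 0 = 0 := by
  have h := contactField_smul 0 0 0
  rwa [zero_smul, zero_smul] at h

/-- The space of the fields with a contact potential and a Kohn-harmonic inhomogeneity. -/
def contactFields : Submodule ℝ VField where
  carrier := {S | ∃ h b, IsContactPotential h ∧ lap b = 0 ∧ S = contactField h b 0}
  add_mem' := by
    rintro _ _ ⟨h, b, H, hb, rfl⟩ ⟨k, b', K, hb', rfl⟩
    exact ⟨h + k, b + b', H.add K, by rw [lap_add, hb, hb', add_zero],
      (contactField_add h k b b').symm⟩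
  zero_mem' := ⟨0, 0, isContactPotential_zero, lap_zero, contactField_zero.symm⟩
  smul_mem' := by
    rintro c _ ⟨h, b, H, hb, rfl⟩
    exact ⟨c • h, c • b, H.smul c, by rw [lap_smul, hb, smul_zero], (contactField_smul c h b).symm⟩

theorem lieBracket_mem_contactFields {V V' : VField} (hV : V ∈ contactFields)
    (hV' : V' ∈ contactFields) : VectorField.lieBracket ℝ V V' ∈ contactFields := by
  obtain ⟨h, b, H, hb, rfl⟩ := hV
  obtain ⟨k, b', K, hb', rfl⟩ := hV'
  exact ⟨_, _, H.contactBracket K, by rw [lap_sub, lap_along H hb', lap_along K hb, sub_zero],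
    lieBracket_contactField H K b b'⟩

/-! ### The generators -/

/-- `x² + y²`. -/
def rsq : Sm := coord 0 ^ 2 + coord 1 ^ 2

theorem mkField_eq_contactField (a b c k : ℝ → ℝ → ℝ → ℝ → ℝ) (h : Sm) (s : ℝ)
    (h0 : ∀ (p : Pt) u, a (p 0) (p 1) (p 2) u = (contactXi h 0).1 p)
    (h1 : ∀ (p : Pt) u, b (p 0) (p 1) (p 2) u = (contactXi h 1).1 p)
    (h2 : ∀ (p : Pt) u, c (p 0) (p 1) (p 2) u = (contactXi h 2).1 p)
    (h3 : ∀ (p : Pt) u, k (p 0) (p 1) (p 2) u = (contactA h s).1 p * u) :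
    mkField a b c k = contactField h 0 s := by
  funext q
  refine Prod.ext (funext fun i => ?_) ?_
  · fin_cases i
    exacts [h0 q.1 q.2, h1 q.1 q.2, h2 q.1 q.2]
  · refine (h3 q.1 q.2).trans ?_
    change _ = aff _ _ q
    simp [aff]

/-- The eight potentials are homogeneous for `(x, y, t) ↦ (rx, ry, r²t)`, of degrees `0, 1, 1, 2, 2,
4, 3, 3` in the order listed. -/
theorem isContactPotential_one : IsContactPotential 1 := ⟨by simp, by simp⟩

theorem isContactPotential_x : IsContactPotential (coord 0) := ⟨by simp, by simp⟩

theorem isContactPotential_y : IsContactPotential (coord 1) := ⟨by simp, by simp⟩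

theorem isContactPotential_t : IsContactPotential (coord 2) := by
  constructor <;> simp only [opX_t, opY_t, map_neg, derivation_mul, derivation_ofNat, opX_x, opX_y,
    opY_x, opY_y] <;> ring

theorem isContactPotential_rsq : IsContactPotential rsq := by
  constructor <;> simp only [rsq, map_add, pow_two, derivation_mul, opX_x, opX_y, opY_x, opY_y,
    map_zero, Derivation.map_one_eq_zero] <;> ring

theorem isContactPotential_V1 : IsContactPotential (coord 2 ^ 2 + rsq ^ 2) := by
  constructor <;> simp only [rsq, map_add, map_neg, pow_two, derivation_mul, derivation_ofNat,
    opX_x, opX_y, opX_t, opY_x, opY_y, opY_t, map_zero, Derivation.map_one_eq_zero] <;> ring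

theorem isContactPotential_V2 : IsContactPotential (coord 0 * rsq - coord 1 * coord 2) := by
  constructor <;> simp only [rsq, map_add, map_sub, map_neg, pow_two, derivation_mul,
    derivation_ofNat, opX_x, opX_y, opX_t, opY_x, opY_y, opY_t, map_zero,
    Derivation.map_one_eq_zero] <;> ring

theorem isContactPotential_V3 : IsContactPotential (coord 0 * coord 2 + coord 1 * rsq) := by
  constructor <;> simp only [rsq, map_add, map_neg, pow_two, derivation_mul,
    derivation_ofNat, opX_x, opX_y, opX_t, opY_x, opY_y, opY_t, map_zero,
    Derivation.map_one_eq_zero] <;> ring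

theorem T_eq : T = contactField 1 0 0 := by
  apply mkField_eq_contactField <;> intro p u <;>
    simp [contactXi_zero, contactXi_one, contactXi_two, contactA]

theorem R_eq : R = contactField ((-2 : ℝ) • rsq) 0 0 := by
  apply mkField_eq_contactField <;> intro p u <;>
    simp only [contactXi_zero, contactXi_one, contactXi_two, contactA, rsq, derivation_smul,
      map_add, pow_two, derivation_mul, opX_x, opX_y, opY_x, opY_y, opT_x, opT_y, map_zero,
      Sm.smul_apply, Sm.add_apply, Sm.sub_apply, Sm.mul_apply, Sm.zero_apply, Sm.one_apply,
      coord_apply] <;> ring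

theorem Xtilde_eq : Xtilde = contactField ((-4 : ℝ) • coord 1) 0 0 := by
  apply mkField_eq_contactField <;> intro p u <;>
    simp only [contactXi_zero, contactXi_one, contactXi_two, contactA, derivation_smul,
      opX_y, opY_y, opT_y, map_zero,
      Sm.smul_apply, Sm.add_apply, Sm.sub_apply, Sm.mul_apply, Sm.zero_apply, Sm.one_apply,
      coord_apply] <;> ring

theorem Ytilde_eq : Ytilde = contactField ((4 : ℝ) • coord 0) 0 0 := by
  apply mkField_eq_contactField <;> intro p u <;>
    simp only [contactXi_zero, contactXi_one, contactXi_two, contactA, derivation_smul,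
      opX_x, opY_x, opT_x, map_zero,
      Sm.smul_apply, Sm.add_apply, Sm.sub_apply, Sm.mul_apply, Sm.zero_apply, Sm.one_apply,
      coord_apply] <;> ring

/-- Here `Th/2 = 1`, so `c = 1` is what makes the `u`-component vanish. -/
theorem Z_eq : Z = contactField ((2 : ℝ) • coord 2) 0 1 := by
  apply mkField_eq_contactField <;> intro p u <;>
    simp only [contactXi_zero, contactXi_one, contactXi_two, contactA, derivation_smul,
      opX_t, opY_t, opT_t, Sm.algebraMap_apply, Sm.neg_apply, Sm.ofNat_apply,
      Sm.smul_apply, Sm.add_apply, Sm.sub_apply, Sm.mul_apply, Sm.one_apply,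
      coord_apply] <;> ring

theorem U_eq : U = contactField 0 0 1 := by
  apply mkField_eq_contactField <;> intro p u <;>
    simp [contactXi_zero, contactXi_one, contactXi_two, contactA]

theorem V1_eq : V1 = contactField (coord 2 ^ 2 + rsq ^ 2) 0 0 := by
  apply mkField_eq_contactField <;> intro p u <;>
    simp only [contactXi_zero, contactXi_one, contactXi_two, contactA, rsq,
      map_add, pow_two, derivation_mul, opX_x, opX_y, opX_t, opY_x, opY_y, opY_t, opT_x, opT_y,
      opT_t, map_zero, Sm.neg_apply, Sm.ofNat_apply,
      Sm.smul_apply, Sm.add_apply, Sm.sub_apply, Sm.mul_apply, Sm.zero_apply, Sm.one_apply,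
      coord_apply] <;> ring

theorem V2_eq : V2 = contactField ((4 : ℝ) • (coord 0 * rsq - coord 1 * coord 2)) 0 0 := by
  apply mkField_eq_contactField <;> intro p u <;>
    simp only [contactXi_zero, contactXi_one, contactXi_two, contactA, rsq, derivation_smul, map_sub,
      map_add, pow_two, derivation_mul, opX_x, opX_y, opX_t, opY_x, opY_y, opY_t, opT_x, opT_y,
      opT_t, map_zero, Sm.neg_apply, Sm.ofNat_apply,
      Sm.smul_apply, Sm.add_apply, Sm.sub_apply, Sm.mul_apply, Sm.zero_apply, Sm.one_apply,
      coord_apply] <;> ring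

theorem V3_eq : V3 = contactField ((4 : ℝ) • (coord 0 * coord 2 + coord 1 * rsq)) 0 0 := by
  apply mkField_eq_contactField <;> intro p u <;>
    simp only [contactXi_zero, contactXi_one, contactXi_two, contactA, rsq, derivation_smul,
      map_add, pow_two, derivation_mul, opX_x, opX_y, opX_t, opY_x, opY_y, opY_t, opT_x, opT_y,
      opT_t, map_zero, Sm.neg_apply, Sm.ofNat_apply,
      Sm.smul_apply, Sm.add_apply, Sm.sub_apply, Sm.mul_apply, Sm.zero_apply, Sm.one_apply,
      coord_apply] <;> ring

theorem W_eq (b : Sm) : W b.1 = contactField 0 b 0 := by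
  funext q
  refine Prod.ext (funext fun i => ?_) ?_
  · change (0 : ℝ) = (contactXi 0 i).1 q.1
    fin_cases i <;> simp [contactXi]
  · change b.1 q.1 = aff _ _ q
    simp [aff, contactA]

theorem generators_subset_contactFields : generators ⊆ contactFields := by
  rintro S (hS | ⟨β, hβ, hΔ, rfl⟩)
  · simp only [Set.mem_insert_iff, Set.mem_singleton_iff] at hS
    rcases hS with rfl | rfl | rfl | rfl | rfl | rfl | rfl
    exacts [⟨_, 0, isContactPotential_one, lap_zero, T_eq⟩,
      ⟨_, 0, isContactPotential_rsq.smul _, lap_zero, R_eq⟩,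
      ⟨_, 0, isContactPotential_y.smul _, lap_zero, Xtilde_eq⟩,
      ⟨_, 0, isContactPotential_x.smul _, lap_zero, Ytilde_eq⟩,
      ⟨_, 0, isContactPotential_V1, lap_zero, V1_eq⟩,
      ⟨_, 0, isContactPotential_V2.smul _, lap_zero, V2_eq⟩,
      ⟨_, 0, isContactPotential_V3.smul _, lap_zero, V3_eq⟩]
  · exact ⟨0, ⟨β, hβ⟩, isContactPotential_zero,
      Sm.ext_apply_iff.mpr fun p => (kohnLaplacian_eq ⟨β, hβ⟩ p).symm.trans (hΔ p), W_eq ⟨β, hβ⟩⟩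

/-- A contact potential is a combination of the eight polynomial ones. -/
theorem IsContactPotential.eq_combination {h : Sm} (H : IsContactPotential h) :
    h = h.1 0 • (1 : Sm) + (opX h).1 0 • coord 0 + (opY h).1 0 • coord 1 + (opT h).1 0 • coord 2
      + ((opX (opX h)).1 0 / 2) • rsq + ((opT (opT h)).1 0 / 2) • (coord 2 ^ 2 + rsq ^ 2)
      + (-(opT (opY h)).1 0) • (coord 0 * rsq - coord 1 * coord 2)
      + (opT (opX h)).1 0 • (coord 0 * coord 2 + coord 1 * rsq) := by
  have K : IsContactPotential (h + (-1 : ℝ) • (h.1 0 • (1 : Sm) + (opX h).1 0 • coord 0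
      + (opY h).1 0 • coord 1 + (opT h).1 0 • coord 2 + ((opX (opX h)).1 0 / 2) • rsq
      + ((opT (opT h)).1 0 / 2) • (coord 2 ^ 2 + rsq ^ 2)
      + (-(opT (opY h)).1 0) • (coord 0 * rsq - coord 1 * coord 2)
      + (opT (opX h)).1 0 • (coord 0 * coord 2 + coord 1 * rsq))) :=
    H.add ((((((((isContactPotential_one.smul _).add (isContactPotential_x.smul _)).add
      (isContactPotential_y.smul _)).add (isContactPotential_t.smul _)).add
      (isContactPotential_rsq.smul _)).add (isContactPotential_V1.smul _)).add
      (isContactPotential_V2.smul _)).add (isContactPotential_V3.smul _) |>.smul _)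
  refine sub_eq_zero.mp ((sub_eq_add_neg _ _).trans ?_)
  rw [← neg_one_smul ℝ]
  -- At the origin the polynomials are dual to the eight values up to scalars: `X²(r²) = 2`, `T²(t²
  -- + r⁴) = 2`, `TY(x r² - y t) = -1`, the rest `1`.
  apply K.eq_zero <;>
    simp only [rsq, map_add, map_sub, map_neg, derivation_smul, pow_two, derivation_mul,
      derivation_ofNat, opX_x, opX_y, opX_t, opY_x, opY_y, opY_t, opT_x, opT_y, opT_t, map_zero,
      Derivation.map_one_eq_zero, Sm.smul_apply, Sm.add_apply, Sm.sub_apply, Sm.neg_apply,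
      Sm.mul_apply, Sm.ofNat_apply, Sm.zero_apply, Sm.one_apply, coord_apply,
      Pi.zero_apply] <;> ring

/-- The potentials whose fields lie in `A` form a subspace, so it suffices that it contains the
eight polynomials. -/
theorem contactFields_subset {A : Submodule ℝ VField} (hG : generators ⊆ A)
    (hA : ∀ V ∈ A, ∀ V' ∈ A, VectorField.lieBracket ℝ V V' ∈ A) {h b : Sm}
    (H : IsContactPotential h) (hb : lap b = 0) : contactField h b 0 ∈ A := by
  let P : Submodule ℝ Sm :=
    { carrier := {k | contactField k 0 0 ∈ A}
      add_mem' := fun {k l} hk hl => by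
        have h1 := contactField_add k l 0 0
        rw [add_zero] at h1
        change contactField (k + l) 0 0 ∈ A
        rw [h1]; exact A.add_mem hk hl
      zero_mem' := by
        change contactField 0 0 0 ∈ A
        rw [contactField_zero]; exact A.zero_mem
      smul_mem' := fun c k hk => by
        have h1 := contactField_smul c k 0
        rw [smul_zero] at h1
        change contactField (c • k) 0 0 ∈ A
        rw [h1]; exact A.smul_mem c hk }
  have unscale : ∀ {c : ℝ} {k : Sm}, c ≠ 0 → contactField (c • k) 0 0 ∈ A → k ∈ P :=
    fun hc hk => (P.smul_mem_iff hc).mp hk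
  have gT : contactField 1 0 0 ∈ A := T_eq ▸ hG (by simp [generators])
  have gV1 : contactField (coord 2 ^ 2 + rsq ^ 2) 0 0 ∈ A := V1_eq ▸ hG (by simp [generators])
  -- The one potential absent from the generators: the contact bracket of `1` and `t² + r⁴` is `2t`.
  have mt : coord 2 ∈ P := by
    apply unscale (c := 2) two_ne_zero
    have hbr := hA _ gT _ gV1
    rw [lieBracket_contactField isContactPotential_one isContactPotential_V1] at hbr
    convert hbr using 2
    · refine Sm.ext_apply_iff.mpr fun p => ?_
      simp only [contactBracket, rsq, map_add, pow_two, derivation_mul, opT_x, opT_y, opT_t,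
        Derivation.map_one_eq_zero, Sm.smul_apply, Sm.add_apply, Sm.sub_apply, Sm.mul_apply,
        Sm.zero_apply, Sm.one_apply, coord_apply]
      ring
    · simp [along]
  have mone : (1 : Sm) ∈ P := gT
  have mx : coord 0 ∈ P := unscale (c := 4) (by norm_num) (Ytilde_eq ▸ hG (by simp [generators]))
  have my : coord 1 ∈ P := unscale (c := -4) (by norm_num) (Xtilde_eq ▸ hG (by simp [generators]))
  have mr : rsq ∈ P := unscale (c := -2) (by norm_num) (R_eq ▸ hG (by simp [generators]))
  have m2 : coord 0 * rsq - coord 1 * coord 2 ∈ P :=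
    unscale (c := 4) (by norm_num) (V2_eq ▸ hG (by simp [generators]))
  have m3 : coord 0 * coord 2 + coord 1 * rsq ∈ P :=
    unscale (c := 4) (by norm_num) (V3_eq ▸ hG (by simp [generators]))
  have m1 : coord 2 ^ 2 + rsq ^ 2 ∈ P := gV1
  have hP : h ∈ P := by
    rw [H.eq_combination]
    exact P.add_mem (P.add_mem (P.add_mem (P.add_mem (P.add_mem (P.add_mem (P.add_mem
      (P.smul_mem _ mone) (P.smul_mem _ mx)) (P.smul_mem _ my)) (P.smul_mem _ mt))
      (P.smul_mem _ mr)) (P.smul_mem _ m1)) (P.smul_mem _ m2)) (P.smul_mem _ m3)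
  have hW : contactField 0 b 0 ∈ A := by
    rw [← W_eq]
    exact hG (Or.inr ⟨b.1, b.contDiff, fun p => by
      rw [kohnLaplacian_eq]; exact congrArg (fun f : Sm => f.1 p) hb, rfl⟩)
  have h1 := contactField_add h 0 0 b
  rw [add_zero, zero_add] at h1
  rw [h1]
  exact A.add_mem hP hW

end Kohn

end

/-! ### The main theorem -/

theorem theorem4 :
    {S : Kohn.VField | Kohn.IsNoetherSymmetry Kohn.kohnEq Kohn.kohnLagrangian S} =
        Kohn.lieAlgebraGenerated Kohn.generators ∧
      (Kohn.IsLiePointSymmetry Kohn.kohnEq Kohn.Z ∧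
        ¬ Kohn.IsNoetherSymmetry Kohn.kohnEq Kohn.kohnLagrangian Kohn.Z) ∧
      (Kohn.IsLiePointSymmetry Kohn.kohnEq Kohn.U ∧
        ¬ Kohn.IsNoetherSymmetry Kohn.kohnEq Kohn.kohnLagrangian Kohn.U) := by
  open Kohn in
  have HZ := isContactPotential_t.smul 2
  have HU := isContactPotential_zero
  refine ⟨Set.Subset.antisymm (fun S hS A hG hA => ?_) fun S hS => ?_, ⟨?_, ?_⟩, ⟨?_, ?_⟩⟩
  · obtain ⟨h, b, c, H, hb, rfl⟩ := hS.1.exists_contactField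
    obtain rfl := (isNoetherSymmetry_contactField_iff H hb c).mp hS
    exact contactFields_subset hG hA H hb
  -- `contactFields` is itself one of the bracket-closed subspaces containing the generators.
  · obtain ⟨h, b, H, hb, rfl⟩ := hS contactFields generators_subset_contactFields
      fun V hV V' hV' => lieBracket_mem_contactFields hV hV'
    exact isNoetherSymmetry_contactField H hb
  · rw [Z_eq]
    exact isLiePointSymmetry_contactField HZ lap_zero 1
  · rw [Z_eq, isNoetherSymmetry_contactField_iff HZ lap_zero]
    exact one_ne_zero
  · rw [U_eq]
    exact isLiePointSymmetry_contactField HU lap_zero 1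
  · rw [U_eq, isNoetherSymmetry_contactField_iff HU lap_zero]
    exact one_ne_zero
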